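/- Let $\mathcal H_A,\mathcal H_B,\mathcal H_C$ be finite-dimensional Hilbert spaces, let $\rho=\rho_{ABC}$ be a state (positive semidefinite, trace one) on $\mathcal H_A\otimes\mathcal H_B\otimes\mathcal H_C$ and let $\sigma_{AB}$ be a positive semidefinite operator on $\mathcal H_A\otimes\mathcal H_B$. Write $\rho_{BC}=\mathrm{Tr}_A\rho_{ABC}$ and $\sigma_B=\mathrm{Tr}_A\sigma_{AB}$; an operator on some of the factors is also regarded as an operator on a larger tensor product by tensoring it with the identity. For a positive semidefinite operator $X$ let $X^{-1}$ be its generalized inverse (zero on $\ker X$), and $X^{-\beta}=(X^{-1})^{\beta}$ for $\beta>0$. $L_X$ and $R_X$ denote left and right multiplication by $X$, $R_X^{-1}$ is right multiplication by $X^{-1}$, and $f(L_\sigma R_\rho^{-1})$ is defined by the functional calculus for operators that are self-adjoint with respect to the Hilbert–Schmidt inner product. Let $f:(0,\infty)\to\mathbb R$ be a regular operator monotone decreasing function. That is, $f$ is operator monotone decreasing, and in its canonical integral representation $$f(x)=ax+b+\int_0^\infty\Big(\frac1{t+x}-\frac{t}{t^2+1}\Big)\,d\mu(t),\qquad a\le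 0,\ b\in\mathbb R,\ \int_0^\infty \frac{d\mu(t)}{t^2+1}<\infty ,$$ the positive measure $\mu$ on $(0,\infty)$ is absolutely continuous with respect to Lebesgue measure and for all $S,T>0$ there is a finite constant $C$ with $dt\le C\,d\mu(t)$ on $[1/S,T]$. If $f(0^+)=\lim_{x\downarrow0}f(x)$ is finite, set $f(0)=f(0^+)$; if it is not finite, assume that $\sigma_{AB}$ is positive definite (so that the functional calculus is defined). Assume also that at least one of $\rho_{ABC}$, $\sigma_{AB}$ is positive definite. Then the equality (of operators on $\mathcal H_C$) $$\mathrm{Tr}_{AB}\big(f(L_{\sigma_{AB}}R^{-1}_{\rho_{ABC}})\,\rho_{ABC}\big)=\mathrm{Tr}_{B}\big(f(L_{\sigma_{B}}R^{-1}_{\rho_{BC}})\,\rho_{BC}\big)\tag{1}$$ in Ruskai's operator inequality holds if and only if $$\sigma_B^{\beta}\rho_{BC}^{-\beta}=\sigma_{AB}^{\beta}\rho_{ABC}^{-\beta}\qquad\text{for all }\beta\in(0,1).$$ Moreover, if $\rho_{ABC}$ is positive definite, (1) is equivalent to the Petz recovery condition $\mathscr R_{\rho_{ABC}}(\sigma_B)=\sigma_{AB}$,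 where $\mathscr R_{\rho_{ABC}}(\gamma)=\rho_{ABC}^{1/2}\rho_{BC}^{-1/2}\,\gamma\,\rho_{BC}^{-1/2}\rho_{ABC}^{1/2}$. -/

import Mathlib

open scoped Kronecker ComplexOrder Topology

noncomputable section

namespace QuasiEntropy

/-- `f` is operator monotone decreasing on `(0, ∞)`: if `A ≥ B` are self-adjoint with spectrum in
`(0, ∞)` (that is, positive definite) then `f(A) ≤ f(B)`. -/
def OperatorMonotoneDecreasing (f : ℝ → ℝ) : Prop :=
  ∀ (n : ℕ) (A B : Matrix (Fin n) (Fin n) ℂ), A.PosDef → B.PosDef →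
    (A - B).PosSemidef → (cfc f B - cfc f A).PosSemidef

/-- `(a, b, μ)` is the datum of the canonical integral representation of the operator monotone
decreasing function `f` on `(0, ∞)`:
`f(x) = a x + b + ∫ (1/(t+x) - t/(t²+1)) dμ(t)` with `a ≤ 0`, where `μ` is a positive measure on
`(0, ∞)` with `∫ 1/(t²+1) dμ < ∞`. -/
structure IsCanonicalRepresentation (f : ℝ → ℝ) (a b : ℝ) (μ : MeasureTheory.Measure ℝ) :
    Prop where
  nonpos : a ≤ 0
  supported : μ (Set.Iic 0) = 0
  integrable : MeasureTheory.Integrable (fun t : ℝ => 1 / (t ^ 2 + 1)) μ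
  eq : ∀ x : ℝ, 0 < x → f x = a * x + b + ∫ t, (1 / (t + x) - t / (t ^ 2 + 1)) ∂μ

/-- A regular operator monotone decreasing function: the measure `μ` of its canonical
representation is absolutely continuous with respect to Lebesgue measure, and for all `S, T > 0`
there is a finite constant `C` with `dt ≤ C dμ(t)` on `[1/S, T]`. -/
def IsRegular (f : ℝ → ℝ) : Prop :=
  OperatorMonotoneDecreasing f ∧
  ∃ (a b : ℝ) (μ : MeasureTheory.Measure ℝ), IsCanonicalRepresentation f a b μ ∧
    μ.AbsolutelyContinuous MeasureTheory.volume ∧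
    ∀ S T : ℝ, 0 < S → 0 < T → ∃ C : NNReal,
      MeasureTheory.volume.restrict (Set.Icc (1 / S) T) ≤
        (C : ENNReal) • μ.restrict (Set.Icc (1 / S) T)

section Matrices

variable {m n a b c : Type*} [Fintype m] [DecidableEq m] [Fintype n] [DecidableEq n]
  [Fintype a] [DecidableEq a] [Fintype b] [DecidableEq b] [Fintype c] [DecidableEq c]

/-- The real power `A ^ s` of a positive semidefinite matrix. Since `0 ^ s = 0` for `s ≠ 0` in
Mathlib, a negative power is the power of the generalized inverse, which vanishes on `ker A`. -/
def mpow (A : Matrix n n ℂ) (s : ℝ) : Matrix n n ℂ := cfc (fun x : ℝ => x ^ s) A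

/-- The generalized inverse of a self-adjoint matrix: nonzero eigenvalues are inverted, and the
eigenvalue `0` stays (`0⁻¹ = 0`). -/
def genInv (A : Matrix n n ℂ) : Matrix n n ℂ := cfc (fun x : ℝ => x⁻¹) A

/-- The partial trace over the first tensor factor. -/
def trFst (M : Matrix (m × n) (m × n) ℂ) : Matrix n n ℂ :=
  Matrix.of fun i j => ∑ k, M (k, i) (k, j)

/-- The operator `X ⊗ I_C` on `H_A ⊗ H_B ⊗ H_C`, for `X` on `H_A ⊗ H_B`. -/
def tensorOne (X : Matrix (a × b) (a × b) ℂ) : Matrix (a × b × c) (a × b × c) ℂ :=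
  Matrix.reindex (Equiv.prodAssoc a b c) (Equiv.prodAssoc a b c) (X ⊗ₖ (1 : Matrix c c ℂ))

/-- The relative modular operator `L_σ R_ρ⁻¹ : X ↦ σ X ρ⁻¹`. -/
def modular (σ ρ : Matrix n n ℂ) : Matrix n n ℂ →ₗ[ℂ] Matrix n n ℂ :=
  LinearMap.mulLeft ℂ σ ∘ₗ LinearMap.mulRight ℂ (genInv ρ)

/-- The functional calculus `f(Φ)` of a linear map `Φ` on matrices which is self-adjoint for the
Hilbert-Schmidt inner product, computed in the orthonormal basis of matrix units. -/
def superCfc (f : ℝ → ℝ) (Φ : Matrix n n ℂ →ₗ[ℂ] Matrix n n ℂ) :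
    Matrix n n ℂ →ₗ[ℂ] Matrix n n ℂ :=
  Matrix.toLin (Matrix.stdBasis ℂ n n) (Matrix.stdBasis ℂ n n)
    (cfc f (LinearMap.toMatrix (Matrix.stdBasis ℂ n n) (Matrix.stdBasis ℂ n n) Φ))

/-- The Petz recovery map
`γ ↦ ρ^{1/2} ρ₂^{-1/2} γ ρ₂^{-1/2} ρ^{1/2}` of the partial trace over the first factor, where `ρ₂`
is the corresponding reduction of `ρ` and operators on the second factor act as `I ⊗ ·`. -/
def petz (ρ : Matrix (m × n) (m × n) ℂ) (γ : Matrix n n ℂ) : Matrix (m × n) (m × n) ℂ :=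
  mpow ρ (1 / 2) *
    ((1 : Matrix m m ℂ) ⊗ₖ (mpow (trFst ρ) (-(1 / 2)) * γ * mpow (trFst ρ) (-(1 / 2)))) *
    mpow ρ (1 / 2)

/-- Equality in Ruskai's operator inequality, an identity between operators on `H_C`:
`Tr_AB (f(L_{σ_AB} R_{ρ_ABC}⁻¹) ρ_ABC) = Tr_B (f(L_{σ_B} R_{ρ_BC}⁻¹) ρ_BC)`. -/
def RuskaiEquality (f : ℝ → ℝ) (ρ : Matrix (a × b × c) (a × b × c) ℂ)
    (σ : Matrix (a × b) (a × b) ℂ) : Prop :=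
  trFst (trFst (superCfc f (modular (tensorOne σ) ρ) ρ)) =
    trFst (superCfc f (modular (trFst σ ⊗ₖ (1 : Matrix c c ℂ)) (trFst ρ)) (trFst ρ))

end Matrices

end QuasiEntropy

end

/-! Write `Γ = σ_AB ⊗ I_C`, let `ρ₂ = ρ_BC` and `Γ₂ = σ_B ⊗ I_C` be the reductions, and set `Δ = L_Γ
R_ρ⁻¹`, `Δ₂ = L_{Γ₂} R_{ρ₂}⁻¹`. The map `V y = (I ⊗ y ρ₂^{-1/2}) ρ^{1/2}` is a contraction with `V
ρ₂^{1/2} = ρ^{1/2}` and `V* Δ V ≤ Δ₂` (`isModularContraction_stateEmbedding`). Completing a square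
then shows that the quasi-entropy `⟨ρ^{1/2}, (t + Δ)⁻¹ ρ^{1/2}⟩` is at least its reduced
counterpart, with a gap of at least `t ‖(t + Δ)⁻¹ ρ^{1/2} - V (t + Δ₂)⁻¹ ρ₂^{1/2}‖²`
(`resolvent_gap`).

Suppose (1) holds, and take its trace over C. The canonical representation writes the difference of
the `f`-quasi-entropies as a nonnegative linear contribution plus a `μ`-integral of these gaps.
Regularity makes the gap vanish for almost every `t` in an interval. As the spectra are finite, the
gap is a rational function of `t` and vanishes identically (`exists_infinite_resolvent_eq_zero`,
`sum_mul_eq_zero_of_resolvent`). Hence `g(Δ) ρ^{1/2} = V g(Δ₂) ρ₂^{1/2}` for all `g`, which is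
`Intertwines`.

`Intertwines` is the hub. With `g = f` it gives back (1) as an operator identity. With `g(x) = x^β`
it gives the power condition after cancelling `ρ^{1/2}`; when `ρ` is singular this needs `supp ρ = I
⊗ supp ρ₂`, which follows from equality of energies (`supp_trFst_eq`). Conversely, constants and
powers determine all `g` on a finite spectrum. The case `β = 1/2` yields Petz recovery, and recovery
provides a contraction in the opposite direction, so the resolvent quasi-entropies coincide. -/

namespace QuasiEntropy

noncomputable section

set_option linter.unusedSectionVars false

/-! ### Spectral resolutions and the functional calculus of the relative modular operator -/

section SpectralResolution

open Matrix

variable {ι κ m n : Type*} [Fintype ι] [DecidableEq ι] [Fintype κ] [DecidableEq κ]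
  [Fintype m] [DecidableEq m] [Fintype n] [DecidableEq n]

/-- A finite family of mutually orthogonal projections which sum to the identity. -/
structure IsResolution (P : ι → Matrix n n ℂ) : Prop where
  herm : ∀ i, (P i)ᴴ = P i
  mul : ∀ i j, P i * P j = if i = j then P i else 0
  sum : ∑ i, P i = 1

namespace IsResolution

variable {P : ι → Matrix n n ℂ} {Q : κ → Matrix m m ℂ}

theorem sum_mul_sum (hP : IsResolution P) (d e : ι → ℂ) :
    (∑ i, d i • P i) * (∑ i, e i • P i) = ∑ i, (d i * e i) • P i := by
  simp [Finset.sum_mul_sum, hP.mul, smul_smul, mul_comm]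

theorem isHermitian (hP : IsResolution P) (d : ι → ℝ) :
    (∑ i, (d i : ℂ) • P i).IsHermitian := by
  simp [Matrix.IsHermitian, conjTranspose_sum, hP.herm]

theorem aeval_sum (hP : IsResolution P) (d : ι → ℝ) (p : Polynomial ℝ) :
    Polynomial.aeval (∑ i, (d i : ℂ) • P i) p = ∑ i, ((p.eval (d i) : ℝ) : ℂ) • P i := by
  induction p using Polynomial.induction_on' with
  | add p q hp hq =>
    rw [map_add, hp, hq, ← Finset.sum_add_distrib]
    exact Finset.sum_congr rfl fun i _ => by rw [Polynomial.eval_add, Complex.ofReal_add, add_smul]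
  | monomial k r =>
    have h : ∀ k : ℕ, (∑ i, (d i : ℂ) • P i) ^ k = ∑ i, ((d i : ℂ) ^ k) • P i := by
      intro k
      induction k with
      | zero => simp [hP.sum]
      | succ k ih => rw [pow_succ, ih, hP.sum_mul_sum]; simp [pow_succ]
    rw [Polynomial.aeval_monomial, h, ← Algebra.smul_def, Finset.smul_sum]
    refine Finset.sum_congr rfl fun i _ => ?_
    ext a b
    simp [mul_assoc]

/-- The functional calculus in terms of a spectral resolution. -/
theorem cfc_sum (hP : IsResolution P) (d : ι → ℝ) (g : ℝ → ℝ) :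
    cfc g (∑ i, (d i : ℂ) • P i) = ∑ i, (g (d i) : ℂ) • P i := by
  set A := ∑ i, (d i : ℂ) • P i with hA
  have hAh : IsSelfAdjoint A := hP.isHermitian d
  -- The values `d i` are added to the nodes because `d i` need not lie in the spectrum when `P i =
  -- 0`.
  let S : Finset ℝ := (Matrix.finite_real_spectrum (A := A)).toFinset ∪ Finset.univ.image d
  let p : Polynomial ℝ := Lagrange.interpolate S id g
  have hp : ∀ x ∈ S, p.eval x = g x := fun x hx =>
    Lagrange.eval_interpolate_at_node g (Set.injOn_id _) hx
  have h1 : cfc g A = cfc p.eval A := by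
    refine cfc_congr fun x hx => (hp x ?_).symm
    simp [S, hx]
  rw [h1, cfc_polynomial p A hAh, hA, hP.aeval_sum]
  refine Finset.sum_congr rfl fun i _ => ?_
  rw [hp]
  simp [S]

theorem kronecker (hP : IsResolution P) (hQ : IsResolution Q) :
    IsResolution (fun k : ι × κ => P k.1 ⊗ₖ Q k.2) where
  herm k := by rw [conjTranspose_kronecker, hP.herm, hQ.herm]
  mul k l := by
    obtain ⟨i, j⟩ := k
    obtain ⟨i', j'⟩ := l
    rw [← mul_kronecker_mul, hP.mul, hQ.mul]
    by_cases h : i = i' <;> by_cases h' : j = j' <;> simp [h, h']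
  sum := by
    have : ∑ k : ι × κ, P k.1 ⊗ₖ Q k.2 = (∑ i, P i) ⊗ₖ (∑ j, Q j) := by
      rw [Fintype.sum_prod_type]
      ext a b
      simp [Matrix.sum_apply, kroneckerMap_apply, Finset.sum_mul_sum]
    rw [this, hP.sum, hQ.sum, one_kronecker_one]

theorem transpose (hP : IsResolution P) : IsResolution (fun i => (P i)ᵀ) where
  herm i := by
    conv_rhs => rw [← hP.herm i]
    rfl
  mul i j := by
    rw [← transpose_mul, hP.mul]
    by_cases h : i = j
    · simp [h]
    · simp [h, Ne.symm h]
  sum := by rw [← transpose_sum, hP.sum, transpose_one]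

end IsResolution

/-- The spectral theorem. -/
theorem exists_isResolution {A : Matrix n n ℂ} (hA : A.IsHermitian) :
    ∃ P : n → Matrix n n ℂ, IsResolution P ∧ A = ∑ i, (hA.eigenvalues i : ℂ) • P i := by
  set U : Matrix n n ℂ := ↑hA.eigenvectorUnitary with hU
  have h1 : Uᴴ * U = 1 := Unitary.coe_star_mul_self hA.eigenvectorUnitary
  have h2 : U * Uᴴ = 1 := Unitary.coe_mul_star_self hA.eigenvectorUnitary
  refine ⟨fun i => U * single i i 1 * Uᴴ, ⟨fun i => ?_, fun i j => ?_, ?_⟩, ?_⟩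
  · simp [conjTranspose_mul, Matrix.mul_assoc]
  · have : U * single i i 1 * Uᴴ * (U * single j j 1 * Uᴴ) =
        U * (single i i 1 * (Uᴴ * U) * single j j 1) * Uᴴ := by
      simp only [Matrix.mul_assoc]
    rw [this, h1, Matrix.mul_one]
    split_ifs with h
    · subst h; simp
    · simp [single_mul_single_of_ne, h]
  · rw [← Finset.sum_mul, ← Finset.mul_sum, Matrix.sum_single_one, Matrix.mul_one, h2]
  · conv_lhs => rw [hA.spectral_theorem, Unitary.conjStarAlgAut_apply]
    have : diagonal (RCLike.ofReal ∘ hA.eigenvalues) =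
        ∑ i, (hA.eigenvalues i : ℂ) • single i i (1 : ℂ) := by
      simp [← Matrix.sum_single_eq_diagonal]
    rw [this, Finset.mul_sum, Finset.sum_mul]
    refine Finset.sum_congr rfl fun i _ => ?_
    rw [Matrix.mul_smul, Matrix.smul_mul, star_eq_conjTranspose]

/-- This turns the functional calculus of `L_A R_B` into that of a Kronecker product, whose spectral
resolution is the product of those of the factors. -/
theorem toMatrix_mulLeft_comp_mulRight (A B : Matrix n n ℂ) :
    LinearMap.toMatrix (Matrix.stdBasis ℂ n n) (Matrix.stdBasis ℂ n n)
      (LinearMap.mulLeft ℂ A ∘ₗ LinearMap.mulRight ℂ B) = A ⊗ₖ Bᵀ := by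
  ext ⟨i, j⟩ ⟨k, l⟩
  rw [LinearMap.toMatrix_apply, Matrix.stdBasis_eq_single]
  have : ((stdBasis ℂ n n).repr ((LinearMap.mulLeft ℂ A ∘ₗ LinearMap.mulRight ℂ B)
      (single k l 1))) (i, j) = (A * (single k l (1 : ℂ) * B)) i j := by
    simp [Matrix.stdBasis]
  rw [this, kroneckerMap_apply, transpose_apply, Matrix.mul_apply]
  simp [Matrix.mul_apply, single_apply, Finset.sum_ite_eq, ite_and]

theorem toLin_kronecker_transpose (A B : Matrix n n ℂ) :
    Matrix.toLin (Matrix.stdBasis ℂ n n) (Matrix.stdBasis ℂ n n) (A ⊗ₖ Bᵀ) =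
      LinearMap.mulLeft ℂ A ∘ₗ LinearMap.mulRight ℂ B := by
  rw [← toMatrix_mulLeft_comp_mulRight, Matrix.toLin_toMatrix]

theorem IsResolution.genInv_sum {P : ι → Matrix n n ℂ} (hP : IsResolution P) (d : ι → ℝ) :
    genInv (∑ i, (d i : ℂ) • P i) = ∑ i, (((d i)⁻¹ : ℝ) : ℂ) • P i :=
  hP.cfc_sum d _

theorem IsResolution.mpow_sum {P : ι → Matrix n n ℂ} (hP : IsResolution P) (d : ι → ℝ) (r : ℝ) :
    mpow (∑ i, (d i : ℂ) • P i) r = ∑ i, ((d i ^ r : ℝ) : ℂ) • P i :=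
  hP.cfc_sum d _

/-- The functional calculus of the relative modular operator as a double spectral sum. -/
theorem superCfc_modular_sum {P : ι → Matrix n n ℂ} {Q : κ → Matrix n n ℂ}
    (hP : IsResolution P) (hQ : IsResolution Q) (s : ι → ℝ) (r : κ → ℝ) (g : ℝ → ℝ)
    (X : Matrix n n ℂ) :
    superCfc g (modular (∑ i, (s i : ℂ) • P i) (∑ j, (r j : ℂ) • Q j)) X =
      ∑ k : ι × κ, (g (s k.1 * (r k.2)⁻¹) : ℂ) • (P k.1 * X * Q k.2) := by
  have hR := hP.kronecker hQ.transpose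
  have h : LinearMap.toMatrix (Matrix.stdBasis ℂ n n) (Matrix.stdBasis ℂ n n)
      (modular (∑ i, (s i : ℂ) • P i) (∑ j, (r j : ℂ) • Q j)) =
      ∑ k : ι × κ, ((s k.1 * (r k.2)⁻¹ : ℝ) : ℂ) • (P k.1 ⊗ₖ (Q k.2)ᵀ) := by
    rw [modular, toMatrix_mulLeft_comp_mulRight, hQ.genInv_sum, Fintype.sum_prod_type,
      transpose_sum]
    ext a b
    simp only [kroneckerMap_apply, Matrix.sum_apply, Finset.sum_mul_sum, Matrix.smul_apply,
      transpose_apply, smul_eq_mul]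
    push_cast
    exact Finset.sum_congr rfl fun i _ => Finset.sum_congr rfl fun j _ => by ring
  rw [superCfc, h, hR.cfc_sum]
  simp only [map_sum, map_smul, LinearMap.sum_apply, LinearMap.smul_apply,
    toLin_kronecker_transpose]
  simp [Matrix.mul_assoc]

end SpectralResolution

/-! ### Test functions that separate finitely supported measures -/

section Separation

open MeasureTheory Filter

section Interpolation

variable {ι : Type*} [Fintype ι]

/-- The points `l i` may coincide; grouping the masses by location is what makes separation
arguments possible. -/
theorem sum_mul_eq_sum_fiber (l : ι → ℝ) (z : ι → ℂ) (g : ℝ → ℝ) :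
    ∑ i, (g (l i) : ℂ) * z i =
      ∑ x ∈ Finset.univ.image l, (g x : ℂ) * ∑ i with l i = x, z i := by
  rw [← Finset.sum_fiberwise_of_maps_to (s := Finset.univ) (t := Finset.univ.image l) (g := l)
    (fun i _ => Finset.mem_image_of_mem l (Finset.mem_univ i))]
  refine Finset.sum_congr rfl fun x _ => ?_
  rw [Finset.mul_sum]
  refine Finset.sum_congr rfl fun i hi => ?_
  rw [(Finset.mem_filter.1 hi).2]

/-- The functions `x ↦ 1 / (t + x)`, for infinitely many `t > 0`, separate finitely supported
complex measures on `[0, ∞)`. -/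
theorem sum_mul_eq_zero_of_resolvent (l : ι → ℝ) (hl : ∀ i, 0 ≤ l i) (z : ι → ℂ) {T : Set ℝ}
    (hT : T.Infinite) (hpos : T ⊆ Set.Ioi 0)
    (h : ∀ t ∈ T, ∑ i, ((1 / (t + l i) : ℝ) : ℂ) * z i = 0) (g : ℝ → ℝ) :
    ∑ i, (g (l i) : ℂ) * z i = 0 := by
  set S := Finset.univ.image l with hS
  set Z : ℝ → ℂ := fun x => ∑ i with l i = x, z i with hZ
  have hSnn : ∀ x ∈ S, 0 ≤ x := by
    intro x hx
    obtain ⟨i, -, rfl⟩ := Finset.mem_image.1 hx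
    exact hl i
  -- `p` is the numerator of `∑ Z x / (t + x)` over the common denominator.
  let p : Polynomial ℂ := ∑ x ∈ S, Polynomial.C (Z x) *
    ∏ y ∈ S.erase x, (Polynomial.X + Polynomial.C (y : ℂ))
  have heval : ∀ t : ℂ, p.eval t = ∑ x ∈ S, Z x * ∏ y ∈ S.erase x, (t + y) := by
    intro t
    simp [p, Polynomial.eval_finsetSum, Polynomial.eval_prod]
  have hroot : ∀ t ∈ T, p.eval (t : ℂ) = 0 := by
    intro t ht
    have ht0 : 0 < t := hpos ht
    have h1 := h t ht
    rw [sum_mul_eq_sum_fiber l z (fun x => 1 / (t + x))] at h1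
    rw [heval, ← mul_zero (∏ y ∈ S, ((t : ℂ) + y)), ← h1, Finset.mul_sum]
    refine Finset.sum_congr rfl fun x hx => ?_
    have hne : (t : ℂ) + x ≠ 0 := by
      have := hSnn x hx
      have : t + x ≠ 0 := by positivity
      exact_mod_cast this
    rw [← Finset.mul_prod_erase S _ hx]
    push_cast
    field_simp
    ring
  have hp : p = 0 := by
    refine Polynomial.eq_zero_of_infinite_isRoot p ?_
    refine (hT.image (f := fun t : ℝ => (t : ℂ)) (Complex.ofReal_injective.injOn)).mono ?_
    rintro _ ⟨t, ht, rfl⟩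
    exact hroot t ht
  have hZ0 : ∀ x ∈ S, Z x = 0 := by
    intro x hx
    -- At `t = -x` only the product that omits the factor of `x` survives, so `p = 0` isolates `Z
    -- x`.
    have h1 := heval (-x)
    rw [hp, Polynomial.eval_zero, Finset.sum_eq_single_of_mem x hx] at h1
    · refine (mul_eq_zero.1 h1.symm).resolve_right (Finset.prod_ne_zero_iff.2 fun y hy => ?_)
      have : y ≠ x := Finset.ne_of_mem_erase hy
      rw [neg_add_eq_sub, sub_ne_zero]
      exact_mod_cast this
    · intro y _ hy
      rw [Finset.prod_eq_zero (Finset.mem_erase.2 ⟨hy.symm, hx⟩) (by simp), mul_zero]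
  rw [sum_mul_eq_sum_fiber]
  exact Finset.sum_eq_zero fun x hx => by rw [show ∑ i with l i = x, z i = 0 from hZ0 x hx, mul_zero]

/-- The constants and the powers `x ↦ x ^ β`, `0 < β < 1`, separate finitely supported complex
measures on `[0, ∞)`. -/
theorem sum_mul_eq_zero_of_rpow (l : ι → ℝ) (hl : ∀ i, 0 ≤ l i) (z : ι → ℂ)
    (h1 : ∑ i, z i = 0)
    (h : ∀ β ∈ Set.Ioo (0 : ℝ) 1, ∑ i, ((l i ^ β : ℝ) : ℂ) * z i = 0) (g : ℝ → ℝ) :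
    ∑ i, (g (l i) : ℂ) * z i = 0 := by
  set S := Finset.univ.image l with hS
  set Z : ℝ → ℂ := fun x => ∑ i with l i = x, z i with hZ
  have hSnn : ∀ x ∈ S, 0 ≤ x := by
    intro x hx
    obtain ⟨i, -, rfl⟩ := Finset.mem_image.1 hx
    exact hl i
  -- In the variable `w = x^{1/N}` the polynomials of degree below `N` involve only the constants
  -- and the powers `x^{k/N}` with `0 < k/N < 1`, and they interpolate any function on the points of
  -- `S`.
  set N : ℕ := S.card + 1 with hN
  have hN0 : (N : ℝ) ≠ 0 := by positivity
  set w : ℝ → ℝ := fun x => x ^ (1 / (N : ℝ)) with hw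
  have hwinj : Set.InjOn w S := by
    intro x hx y hy hxy
    have := congrArg (fun r : ℝ => r ^ (N : ℝ)) hxy
    simpa [hw, ← Real.rpow_mul (hSnn x hx), ← Real.rpow_mul (hSnn y hy), hN0] using this
  have hpow : ∀ k : ℕ, k < N → ∑ x ∈ S, ((w x : ℂ) ^ k) * Z x = 0 := by
    intro k hk
    rcases Nat.eq_zero_or_pos k with rfl | hk0
    · have := sum_mul_eq_sum_fiber l z (fun _ => 1)
      simp only [Complex.ofReal_one, one_mul] at this
      simp only [pow_zero, one_mul]
      exact this.symm.trans h1
    · have := h (k / N) ⟨by positivity, by rw [div_lt_one (by positivity)]; exact_mod_cast hk⟩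
      rw [sum_mul_eq_sum_fiber l z (fun x => x ^ ((k : ℝ) / N))] at this
      rw [← this]
      refine Finset.sum_congr rfl fun x hx => ?_
      congr 1
      rw [← Complex.ofReal_pow, hw]
      simp only
      rw [← Real.rpow_mul_natCast (hSnn x hx), one_div_mul_eq_div]
  have hpoly : ∀ p : Polynomial ℝ, p.natDegree < N → ∑ x ∈ S, ((p.eval (w x) : ℝ) : ℂ) * Z x = 0 := by
    intro p hp
    simp only [Polynomial.eval_eq_sum_range' hp, Complex.ofReal_sum, Finset.sum_mul]
    rw [Finset.sum_comm]
    refine Finset.sum_eq_zero fun k hk => ?_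
    rw [← mul_zero ((p.coeff k : ℝ) : ℂ), ← hpow k (Finset.mem_range.1 hk), Finset.mul_sum]
    exact Finset.sum_congr rfl fun x _ => by push_cast; ring
  rw [sum_mul_eq_sum_fiber, ← hpoly (Lagrange.interpolate S w g) ?_]
  · exact Finset.sum_congr rfl fun x hx => by
      rw [Lagrange.eval_interpolate_at_node g hwinj hx]
  · refine lt_of_le_of_lt (Polynomial.natDegree_le_of_degree_le
      (Lagrange.degree_interpolate_lt g hwinj).le) (Nat.lt_succ_self _)

end Interpolation

/-! ### Regular functions and zeros of the resolvent transform -/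

section Representation

variable {f : ℝ → ℝ} {a b : ℝ} {μ : Measure ℝ}

/-- The kernel equals `(1 - t x) / (t + x)` times `1 / (t² + 1)`, and the first factor is bounded in
`t`. -/
theorem norm_kernel_le {x t : ℝ} (hx : 0 < x) (ht : 0 < t) :
    ‖1 / (t + x) - t / (t ^ 2 + 1)‖ ≤ (1 / x + x) * (1 / (t ^ 2 + 1)) := by
  have h1 : 1 / (t + x) - t / (t ^ 2 + 1) = (1 - t * x) / (t + x) * (1 / (t ^ 2 + 1)) := by
    field_simp
    ring
  rw [h1, norm_mul, Real.norm_eq_abs, Real.norm_eq_abs, abs_of_pos (by positivity : 0 < 1 / (t ^ 2 + 1))]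
  gcongr
  rw [abs_div, abs_of_pos (by positivity : 0 < t + x), div_le_iff₀ (by positivity)]
  have h2 : |1 - t * x| ≤ 1 + t * x := by
    rw [abs_le]
    constructor <;> nlinarith [mul_pos ht hx]
  have h3 : (1 / x + x) * (t + x) = 1 + t * x + t / x + x ^ 2 := by
    field_simp
    ring
  rw [h3]
  have : 0 ≤ t / x := by positivity
  nlinarith [sq_nonneg x]

theorem IsCanonicalRepresentation.ae_pos (h : IsCanonicalRepresentation f a b μ) :
    ∀ᵐ t ∂μ, 0 < t := by
  rw [ae_iff]
  simpa [Set.Iic_def] using h.supported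

theorem measurable_kernel (x : ℝ) : Measurable fun t : ℝ => 1 / (t + x) - t / (t ^ 2 + 1) := by
  fun_prop

theorem IsCanonicalRepresentation.integrable_kernel (h : IsCanonicalRepresentation f a b μ)
    {x : ℝ} (hx : 0 < x) : Integrable (fun t : ℝ => 1 / (t + x) - t / (t ^ 2 + 1)) μ := by
  refine (h.integrable.const_mul (1 / x + x)).mono' (measurable_kernel x).aestronglyMeasurable ?_
  filter_upwards [h.ae_pos] with t ht using norm_kernel_le hx ht

theorem IsCanonicalRepresentation.continuousAt (h : IsCanonicalRepresentation f a b μ)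
    {x : ℝ} (hx : 0 < x) : ContinuousAt f x := by
  have h1 : ContinuousAt (fun x => a * x + b + ∫ t, (1 / (t + x) - t / (t ^ 2 + 1)) ∂μ) x := by
    refine ContinuousAt.add (by fun_prop) ?_
    refine continuousAt_of_dominated (bound := fun t => (2 / x + 2 * x) * (1 / (t ^ 2 + 1)))
      (.of_forall fun y => (measurable_kernel y).aestronglyMeasurable) ?_
      (h.integrable.const_mul _) ?_
    · filter_upwards [Ioo_mem_nhds (by linarith : x / 2 < x) (by linarith : x < 2 * x)] with y hy
      have hy0 : 0 < y := by linarith [hy.1]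
      filter_upwards [h.ae_pos] with t ht
      refine (norm_kernel_le hy0 ht).trans ?_
      have : 1 / y ≤ 2 / x := by
        rw [div_le_div_iff₀ hy0 hx]
        linarith [hy.1]
      have := hy.2.le
      gcongr
    · filter_upwards [h.ae_pos] with t ht
      have : t + x ≠ 0 := by positivity
      fun_prop (disch := assumption)
  refine h1.congr ?_
  filter_upwards [lt_mem_nhds hx] with y hy using (h.eq y hy).symm

/-- A finitely supported real measure `∑ i, d i • δ (l i)` on `[0, ∞)` whose resolvent transform is
nonnegative, and which annihilates a regular operator monotone decreasing function and the
constants, has a resolvent transform with infinitely many zeros. -/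
theorem IsRegular.exists_infinite_resolvent_eq_zero (hf : IsRegular f) {ι : Type*} [Fintype ι]
    (l : ι → ℝ) (hl : ∀ i, 0 ≤ l i) (d : ι → ℝ) (h_one : ∑ i, d i = 0)
    (h_id : ∑ i, l i * d i ≤ 0) (h_res : ∀ t, 0 < t → 0 ≤ ∑ i, 1 / (t + l i) * d i)
    (h_zero : ∑ i with l i = 0, d i = 0 ∨ Tendsto f (𝓝[>] 0) (𝓝 (f 0)))
    (h_f : ∑ i, f (l i) * d i = 0) :
    ∃ T : Set ℝ, T.Infinite ∧ T ⊆ Set.Ioi 0 ∧ ∀ t ∈ T, ∑ i, 1 / (t + l i) * d i = 0 := by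
  obtain ⟨-, a, b, μ, h, -, hC⟩ := hf
  -- Any interval of positive length would do, since only infinitely many zeros are needed.
  obtain ⟨C, hC⟩ := hC 1 2 one_pos two_pos
  set D : ℝ → ℝ := fun t => ∑ i, 1 / (t + l i) * d i with hD
  -- The representation of `f` is available only on `(0, ∞)`, while some `l i` may be `0`; all
  -- points are therefore shifted by `ε`, which tends to `0` at the end.
  set F : ℝ → ℝ := fun ε => ∑ i, f (l i + ε) * d i with hF
  have hFlim : Tendsto F (𝓝[>] 0) (𝓝 0) := by
    suffices Tendsto F (𝓝[>] 0) (𝓝 (∑ i, f (l i) * d i)) by rwa [h_f] at this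
    -- The points at `0` contribute `f ε` times their total mass: either that mass vanishes or `f`
    -- is right-continuous at `0`.
    have hsplit : ∀ ε, ∑ i, f (l i + ε) * d i =
        f ε * ∑ i with l i = 0, d i + ∑ i with ¬ l i = 0, f (l i + ε) * d i := by
      intro ε
      rw [← Finset.sum_filter_add_sum_filter_not Finset.univ (fun i => l i = 0), Finset.mul_sum]
      congr 1
      refine Finset.sum_congr rfl fun i hi => ?_
      rw [(Finset.mem_filter.1 hi).2, zero_add]
    have h0 := hsplit 0
    simp only [add_zero] at h0
    simp only [hF, hsplit, h0]
    refine Tendsto.add ?_ (tendsto_finsetSum _ fun i hi => ?_)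
    · rcases h_zero with h0 | h0
      · simp [h0]
      · exact h0.mul_const _
    · have hi : 0 < l i := (hl i).lt_of_ne' (Finset.mem_filter.1 hi).2
      have h1 : Tendsto (fun ε => l i + ε) (𝓝[>] 0) (𝓝 (l i)) := by
        have : Tendsto (fun ε : ℝ => l i + ε) (𝓝 0) (𝓝 (l i + 0)) :=
          (continuous_const.add continuous_id).tendsto 0
        rw [add_zero] at this
        exact this.mono_left nhdsWithin_le_nhds
      exact ((h.continuousAt hi).tendsto.comp h1).mul_const _
  -- Total mass zero removes `b`, `a ε` and the regularizing term `t / (t² + 1)`; the remaining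
  -- linear term is a product of two nonpositive numbers and is dropped.
  have hDF : ∀ ε, 0 < ε → Integrable (fun t => D (t + ε)) μ ∧ ∫ t, D (t + ε) ∂μ ≤ F ε := by
    intro ε hε
    have hpos : ∀ i, 0 < l i + ε := fun i => by linarith [hl i]
    have hDeq : (fun t => D (t + ε)) =
        fun t => ∑ i, (1 / (t + (l i + ε)) - t / (t ^ 2 + 1)) * d i := by
      funext t
      simp only [sub_mul, Finset.sum_sub_distrib, ← Finset.mul_sum, h_one, mul_zero, sub_zero, hD]
      exact Finset.sum_congr rfl fun i _ => by ring_nf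
    have hint : ∀ i, Integrable (fun t => (1 / (t + (l i + ε)) - t / (t ^ 2 + 1)) * d i) μ :=
      fun i => (h.integrable_kernel (hpos i)).mul_const _
    rw [hDeq]
    refine ⟨integrable_finsetSum _ fun i _ => hint i, ?_⟩
    rw [integral_finsetSum _ fun i _ => hint i]
    have hFeq : F ε = a * ∑ i, l i * d i +
        ∑ i, ∫ t, (1 / (t + (l i + ε)) - t / (t ^ 2 + 1)) * d i ∂μ := by
      have : ∀ i, f (l i + ε) * d i = a * (l i * d i) + (a * ε + b) * d i +
          ∫ t, (1 / (t + (l i + ε)) - t / (t ^ 2 + 1)) * d i ∂μ := by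
        intro i
        rw [h.eq _ (hpos i), integral_mul_const]
        ring
      simp only [hF, this, Finset.sum_add_distrib, ← Finset.mul_sum, h_one, mul_zero, add_zero]
    rw [hFeq]
    have := mul_nonneg_of_nonpos_of_nonpos h.nonpos h_id
    linarith
  have hlin : ∀ ε, 0 < ε →
      ∫⁻ t in Set.Icc (1 / 1) 2, ENNReal.ofReal (D (t + ε)) ≤ C * ENNReal.ofReal (F ε) := by
    intro ε hε
    obtain ⟨hi, hle⟩ := hDF ε hε
    calc ∫⁻ t in Set.Icc (1 / 1) 2, ENNReal.ofReal (D (t + ε))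
        ≤ ∫⁻ t, ENNReal.ofReal (D (t + ε)) ∂((C : ENNReal) • μ.restrict (Set.Icc (1 / 1) 2)) :=
          lintegral_mono' hC le_rfl
      _ = C * ∫⁻ t in Set.Icc (1 / 1) 2, ENNReal.ofReal (D (t + ε)) ∂μ := by
          rw [lintegral_smul_measure, smul_eq_mul]
      _ ≤ C * ∫⁻ t, ENNReal.ofReal (D (t + ε)) ∂μ := by
          gcongr
          exact Measure.restrict_le_self
      _ = C * ENNReal.ofReal (∫ t, D (t + ε) ∂μ) := by
          rw [ofReal_integral_eq_lintegral_ofReal hi]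
          filter_upwards [h.ae_pos] with t ht using h_res _ (by linarith)
      _ ≤ C * ENNReal.ofReal (F ε) := by gcongr
  have hmeas : Measurable D := by fun_prop
  let e : ℕ → ℝ := fun n => 1 / ((n : ℝ) + 1)
  have he : ∀ n, 0 < e n := fun n => by positivity
  have helim : Tendsto e atTop (𝓝[>] 0) :=
    tendsto_nhdsWithin_iff.2 ⟨tendsto_one_div_add_atTop_nhds_zero_nat, .of_forall he⟩
  have hzero : ∫⁻ t in Set.Icc (1 / 1) 2, ENNReal.ofReal (D t) = 0 := by
    -- Fatou's lemma along `ε = 1 / (n + 1)`.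
    have hle : ∫⁻ t in Set.Icc (1 / 1) 2, ENNReal.ofReal (D t) ≤
        ∫⁻ t in Set.Icc (1 / 1) 2, liminf (fun n => ENNReal.ofReal (D (t + e n))) atTop := by
      refine setLIntegral_mono' measurableSet_Icc fun t ht => ?_
      have ht0 : 0 < t := by linarith [ht.1]
      have hcont : ContinuousAt D t := by
        have : ∀ i, t + l i ≠ 0 := fun i => by linarith [hl i]
        refine tendsto_finsetSum _ fun i _ => ?_
        have := this i
        exact ContinuousAt.mul_const (by fun_prop (disch := assumption)) _
      have h1 : Tendsto (fun n => t + e n) atTop (𝓝 t) := by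
        simpa using (helim.mono_right nhdsWithin_le_nhds).const_add t
      exact ((ENNReal.tendsto_ofReal (hcont.tendsto.comp h1)).liminf_eq).ge
    refine le_antisymm (hle.trans ((lintegral_liminf_le fun n => ?_).trans ?_)) zero_le
    · exact (hmeas.comp (measurable_id.add_const _)).ennreal_ofReal
    · have h1 : Tendsto (fun n => (C : ENNReal) * ENNReal.ofReal (F (e n))) atTop (𝓝 0) := by
        have h2 := ENNReal.tendsto_ofReal (hFlim.comp helim)
        have h3 := ENNReal.Tendsto.const_mul (a := (C : ENNReal)) h2 (Or.inr ENNReal.coe_ne_top)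
        simpa using h3
      rw [← h1.liminf_eq]
      exact liminf_le_liminf (.of_forall fun n => hlin _ (he n))
  have hae : ∀ᵐ t ∂(volume.restrict (Set.Icc (1 / 1) 2)), D t = 0 := by
    rw [lintegral_eq_zero_iff hmeas.ennreal_ofReal] at hzero
    filter_upwards [hzero, ae_restrict_mem measurableSet_Icc] with t ht htm
    exact le_antisymm (ENNReal.ofReal_eq_zero.1 ht) (h_res t (by linarith [htm.1]))
  refine ⟨{t | t ∈ Set.Icc (1 / 1) 2 ∧ D t = 0}, fun hfin => ?_, fun t ht => ?_, fun t ht => ht.2⟩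
  · have h1 : ∀ᵐ t ∂(volume.restrict (Set.Icc (1 / 1 : ℝ) 2)), False := by
      filter_upwards [hae, ae_restrict_mem measurableSet_Icc,
        ae_restrict_of_ae (hfin.countable.ae_notMem volume)] with t h1 h2 h3
      exact h3 ⟨h2, h1⟩
    rw [eventually_false_iff_eq_bot, ae_eq_bot, Measure.restrict_eq_zero] at h1
    norm_num at h1
  · have := ht.1.1
    exact lt_of_lt_of_le (by norm_num) this

end Representation

end Separation

/-! ### Powers, supports and the Hilbert–Schmidt form of the modular operator -/

section Calculus

open Matrix

section PowerCalculus

variable {n : Type*} [Fintype n] [DecidableEq n] {A : Matrix n n ℂ}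

theorem cfc_mul_cfc (A : Matrix n n ℂ) (g h : ℝ → ℝ) :
    cfc g A * cfc h A = cfc (fun x => g x * h x) A := by
  have hfin : ∀ k : ℝ → ℝ, ContinuousOn k (spectrum ℝ A) := fun k =>
    Matrix.finite_real_spectrum.continuousOn k
  rw [← cfc_mul g h A (hfin g) (hfin h)]

theorem cfc_one_of_isHermitian (hA : A.IsHermitian) : cfc (fun _ : ℝ => (1 : ℝ)) A = 1 :=
  cfc_const_one ℝ A (ha := hA)

theorem cfc_id_of_isHermitian (hA : A.IsHermitian) : cfc (fun x : ℝ => x) A = A :=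
  cfc_id' ℝ A (ha := hA)

theorem cfc_congr_of_posSemidef (hA : A.PosSemidef) {g h : ℝ → ℝ} (hgh : ∀ x, 0 ≤ x → g x = h x) :
    cfc g A = cfc h A := by
  obtain ⟨P, hP, hAP⟩ := exists_isResolution hA.1
  rw [hAP, hP.cfc_sum, hP.cfc_sum]
  exact Finset.sum_congr rfl fun i _ => by rw [hgh _ (hA.eigenvalues_nonneg i)]

theorem cfc_congr_of_posDef (hA : A.PosDef) {g h : ℝ → ℝ} (hgh : ∀ x, 0 < x → g x = h x) :
    cfc g A = cfc h A := by
  obtain ⟨P, hP, hAP⟩ := exists_isResolution hA.1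
  rw [hAP, hP.cfc_sum, hP.cfc_sum]
  exact Finset.sum_congr rfl fun i _ => by rw [hgh _ (hA.eigenvalues_pos i)]

theorem conjTranspose_cfc (g : ℝ → ℝ) (A : Matrix n n ℂ) : (cfc g A)ᴴ = cfc g A :=
  (cfc_predicate g A : IsSelfAdjoint _)

theorem conjTranspose_mpow (A : Matrix n n ℂ) (r : ℝ) : (mpow A r)ᴴ = mpow A r :=
  conjTranspose_cfc _ A

/-- The projection onto the support of a self-adjoint matrix. -/
def supp (A : Matrix n n ℂ) : Matrix n n ℂ := cfc (fun x : ℝ => if x = 0 then 0 else 1) A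

theorem conjTranspose_supp (A : Matrix n n ℂ) : (supp A)ᴴ = supp A := conjTranspose_cfc _ A

theorem supp_mul_supp (A : Matrix n n ℂ) : supp A * supp A = supp A := by
  rw [supp, cfc_mul_cfc]
  congr 1
  funext x
  split_ifs <;> simp

theorem supp_eq_one (hA : A.PosDef) : supp A = 1 := by
  rw [supp, cfc_congr_of_posDef hA (h := fun _ => 1) fun x hx => by simp [hx.ne']]
  exact cfc_one_of_isHermitian hA.1

/-- The case `r + s = 0` is excluded because `0 ^ 0 = 1`; there the product can be the support
projection instead of the identity. -/
theorem mpow_mul_mpow (hA : A.PosSemidef) {r s : ℝ} (hrs : r + s ≠ 0) :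
    mpow A r * mpow A s = mpow A (r + s) := by
  rw [mpow, mpow, mpow, cfc_mul_cfc]
  refine cfc_congr_of_posSemidef hA fun x hx => ?_
  rw [Real.rpow_add' hx hrs]

theorem mpow_mul_mpow_neg (hA : A.PosSemidef) {r : ℝ} (hr : r ≠ 0) :
    mpow A r * mpow A (-r) = supp A := by
  rw [mpow, mpow, supp, cfc_mul_cfc]
  refine cfc_congr_of_posSemidef hA fun x hx => ?_
  rcases hx.eq_or_lt with rfl | hx
  · simp [Real.zero_rpow hr]
  · rw [if_neg hx.ne', ← Real.rpow_add hx]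
    simp

theorem mpow_neg_mul_mpow (hA : A.PosSemidef) {r : ℝ} (hr : r ≠ 0) :
    mpow A (-r) * mpow A r = supp A := by
  simpa using mpow_mul_mpow_neg hA (neg_ne_zero.2 hr)

theorem supp_mul_mpow (A : Matrix n n ℂ) {r : ℝ} (hr : r ≠ 0) : supp A * mpow A r = mpow A r := by
  rw [mpow, supp, cfc_mul_cfc]
  congr 1
  funext x
  by_cases hx : x = 0 <;> simp [hx, Real.zero_rpow hr]

theorem mpow_mul_supp (A : Matrix n n ℂ) {r : ℝ} (hr : r ≠ 0) : mpow A r * supp A = mpow A r := by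
  simpa [conjTranspose_mul, conjTranspose_mpow, conjTranspose_supp] using
    congrArg conjTranspose (supp_mul_mpow A hr)

theorem mpow_one (hA : A.IsHermitian) : mpow A 1 = A := by
  rw [mpow]
  simp only [Real.rpow_one]
  exact cfc_id_of_isHermitian hA

theorem mpow_half_mul_mpow_half (hA : A.PosSemidef) : mpow A (1 / 2) * mpow A (1 / 2) = A := by
  rw [mpow_mul_mpow hA (by norm_num), add_halves, mpow_one hA.1]

theorem genInv_eq_mpow (A : Matrix n n ℂ) : genInv A = mpow A (-1) := by
  rw [genInv, mpow]
  simp only [Real.rpow_neg_one]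

theorem genInv_eq (hA : A.PosSemidef) : genInv A = mpow A (-(1 / 2)) * mpow A (-(1 / 2)) := by
  rw [genInv_eq_mpow, mpow_mul_mpow hA (by norm_num)]
  norm_num

end PowerCalculus

section HilbertSchmidt

variable {n : Type*} [Fintype n]

/-- The Hilbert-Schmidt inner product. -/
def hsInner (X Y : Matrix n n ℂ) : ℂ := (Xᴴ * Y).trace

theorem hsInner_add_right (X Y Z : Matrix n n ℂ) :
    hsInner X (Y + Z) = hsInner X Y + hsInner X Z := by
  simp [hsInner, Matrix.mul_add]

theorem hsInner_sub_right (X Y Z : Matrix n n ℂ) :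
    hsInner X (Y - Z) = hsInner X Y - hsInner X Z := by
  simp [hsInner, Matrix.mul_sub]

theorem hsInner_sub_left (X Y Z : Matrix n n ℂ) :
    hsInner (X - Y) Z = hsInner X Z - hsInner Y Z := by
  simp [hsInner, Matrix.sub_mul]

theorem hsInner_smul_right (c : ℂ) (X Y : Matrix n n ℂ) :
    hsInner X (c • Y) = c * hsInner X Y := by
  simp [hsInner]

theorem star_hsInner (X Y : Matrix n n ℂ) : star (hsInner X Y) = hsInner Y X := by
  rw [hsInner, ← trace_conjTranspose, conjTranspose_mul, conjTranspose_conjTranspose, hsInner]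

theorem re_hsInner_comm (X Y : Matrix n n ℂ) : (hsInner X Y).re = (hsInner Y X).re := by
  rw [← star_hsInner Y X]
  simp

theorem re_hsInner_self_nonneg (X : Matrix n n ℂ) : 0 ≤ (hsInner X X).re :=
  (Complex.le_def.1 (posSemidef_conjTranspose_mul_self X).trace_nonneg).1

theorem eq_zero_of_re_hsInner_self_nonpos {X : Matrix n n ℂ} (h : (hsInner X X).re ≤ 0) :
    X = 0 := by
  have h0 := (posSemidef_conjTranspose_mul_self X).trace_nonneg
  rw [← trace_conjTranspose_mul_self_eq_zero_iff]
  refine Complex.ext (le_antisymm h (re_hsInner_self_nonneg X)) ?_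
  exact (Complex.le_def.1 h0).2.symm

/-- The linear functional `X ↦ ⟨Y, X⟩`. -/
def hsInnerLinear (Y : Matrix n n ℂ) : Matrix n n ℂ →ₗ[ℂ] ℂ where
  toFun := hsInner Y
  map_add' := hsInner_add_right Y
  map_smul' c X := hsInner_smul_right c Y X

end HilbertSchmidt

section Modular

variable {n : Type*} [Fintype n] [DecidableEq n] {σ ρ : Matrix n n ℂ}

theorem modular_apply (σ ρ X : Matrix n n ℂ) : modular σ ρ X = σ * (X * genInv ρ) := rfl

theorem hsInner_modular_left (hσ : σ.IsHermitian) (X Y : Matrix n n ℂ) :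
    hsInner (modular σ ρ X) Y = hsInner X (modular σ ρ Y) := by
  have hG : (genInv ρ)ᴴ = genInv ρ := conjTranspose_cfc _ ρ
  rw [hsInner, hsInner, modular_apply, modular_apply, conjTranspose_mul, conjTranspose_mul, hG,
    hσ.eq, Matrix.mul_assoc, Matrix.mul_assoc, trace_mul_comm]
  simp only [Matrix.mul_assoc]

/-- The energy form is a squared norm, by cyclicity of the trace; its positivity and all energy
comparisons below rest on this. -/
theorem hsInner_modular_self (hσ : σ.PosSemidef) (hρ : ρ.PosSemidef) (X : Matrix n n ℂ) :
    hsInner X (modular σ ρ X) =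
      hsInner (mpow σ (1 / 2) * X * mpow ρ (-(1 / 2))) (mpow σ (1 / 2) * X * mpow ρ (-(1 / 2))) := by
  simp only [hsInner, modular_apply, conjTranspose_mul, conjTranspose_mpow]
  rw [Matrix.mul_assoc, trace_mul_comm (mpow ρ (-(1 / 2))), genInv_eq hρ]
  conv_lhs => rw [← mpow_half_mul_mpow_half hσ]
  simp only [Matrix.mul_assoc]

theorem re_hsInner_modular_nonneg (hσ : σ.PosSemidef) (hρ : ρ.PosSemidef) (X : Matrix n n ℂ) :
    0 ≤ (hsInner X (modular σ ρ X)).re := by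
  rw [hsInner_modular_self hσ hρ]
  exact re_hsInner_self_nonneg _

/-- A function of `g : ℝ → ℝ` that is a finite sum of terms `g l • z` with `0 ≤ l`. -/
def IsFinitelySupported {E : Type*} [AddCommGroup E] [Module ℂ E] (L : (ℝ → ℝ) → E) : Prop :=
  ∃ (N : ℕ) (l : Fin N → ℝ) (z : Fin N → E), (∀ i, 0 ≤ l i) ∧
    ∀ g, L g = ∑ i, (g (l i) : ℂ) • z i

namespace IsFinitelySupported

variable {E F : Type*} [AddCommGroup E] [Module ℂ E] [AddCommGroup F] [Module ℂ F]
  {L M : (ℝ → ℝ) → E}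

theorem of_fintype {ι : Type*} [Fintype ι] (l : ι → ℝ) (z : ι → E) (hl : ∀ i, 0 ≤ l i)
    (hL : ∀ g, L g = ∑ i, (g (l i) : ℂ) • z i) : IsFinitelySupported L := by
  let e := (Fintype.equivFin ι).symm
  refine ⟨Fintype.card ι, l ∘ e, z ∘ e, fun i => hl _, fun g => ?_⟩
  rw [hL, ← e.sum_comp]
  rfl

theorem sub (hL : IsFinitelySupported L) (hM : IsFinitelySupported M) :
    IsFinitelySupported fun g => L g - M g := by
  obtain ⟨N, l, z, hl, hL⟩ := hL
  obtain ⟨N', l', z', hl', hM⟩ := hM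
  refine of_fintype (Sum.elim l l') (Sum.elim z (-z')) ?_ fun g => ?_
  · rintro (i | i)
    exacts [hl i, hl' i]
  · simp [hL, hM, sub_eq_add_neg, -Complex.coe_smul]

theorem map (hL : IsFinitelySupported L) (φ : E →ₗ[ℂ] F) :
    IsFinitelySupported fun g => φ (L g) := by
  obtain ⟨N, l, z, hl, hL⟩ := hL
  exact ⟨N, l, fun i => φ (z i), hl, fun g => by simp only [hL, map_sum, map_smul]⟩

theorem eq_zero_of_resolvent {p q : Type*} {L : (ℝ → ℝ) → Matrix p q ℂ}
    (hL : IsFinitelySupported L) {T : Set ℝ} (hT : T.Infinite) (hpos : T ⊆ Set.Ioi 0)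
    (h : ∀ t ∈ T, L (fun x => 1 / (t + x)) = 0) (g : ℝ → ℝ) : L g = 0 := by
  obtain ⟨N, l, z, hl, hL⟩ := hL
  simp only [hL] at h ⊢
  ext i j
  rw [Matrix.sum_apply]
  refine sum_mul_eq_zero_of_resolvent l hl (fun k => z k i j) hT hpos (fun t ht => ?_) g
  simpa [Matrix.sum_apply, -Complex.coe_smul] using congrFun (congrFun (h t ht) i) j

theorem eq_zero_of_rpow {p q : Type*} {L : (ℝ → ℝ) → Matrix p q ℂ}
    (hL : IsFinitelySupported L) (h1 : L (fun _ => 1) = 0)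
    (h : ∀ β ∈ Set.Ioo (0 : ℝ) 1, L (fun x => x ^ β) = 0) (g : ℝ → ℝ) : L g = 0 := by
  obtain ⟨N, l, z, hl, hL⟩ := hL
  simp only [hL] at h h1 ⊢
  ext i j
  rw [Matrix.sum_apply]
  refine sum_mul_eq_zero_of_rpow l hl (fun k => z k i j) ?_ (fun β hβ => ?_) g
  · simpa [Matrix.sum_apply] using congrFun (congrFun h1 i) j
  · simpa [Matrix.sum_apply, -Complex.coe_smul] using congrFun (congrFun (h β hβ) i) j

/-- A functional that annihilates a regular operator monotone decreasing function and the constants,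
is nonpositive at the identity and nonnegative at the resolvents annihilates everything. -/
theorem re_eq_zero_of_isRegular {f : ℝ → ℝ} (hf : IsRegular f) {L : (ℝ → ℝ) → ℂ}
    (hL : IsFinitelySupported L) (h_one : (L fun _ => 1).re = 0) (h_id : (L fun x => x).re ≤ 0)
    (h_res : ∀ t, 0 < t → 0 ≤ (L fun x => 1 / (t + x)).re)
    (h_zero : (L fun x => if x = 0 then 1 else 0).re = 0 ∨
      Filter.Tendsto f (𝓝[>] 0) (𝓝 (f 0)))
    (h_f : (L f).re = 0) (g : ℝ → ℝ) : (L g).re = 0 := by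
  obtain ⟨N, l, z, hl, hL⟩ := hL
  have hre : ∀ g, (L g).re = ∑ i, g (l i) * (z i).re := fun g => by simp [hL]
  simp only [hre] at *
  obtain ⟨T, hT, hpos, hzero⟩ := hf.exists_infinite_resolvent_eq_zero l hl (fun i => (z i).re)
    (by simpa using h_one) h_id h_res
    (h_zero.imp_left fun h => by simpa [Finset.sum_filter] using h) h_f
  have := sum_mul_eq_zero_of_resolvent l hl (fun i => ((z i).re : ℂ)) hT hpos
    (fun t ht => by exact_mod_cast hzero t ht) g
  exact_mod_cast this

end IsFinitelySupported

/-- The support consists of the quotients of eigenvalues of `σ` by those of `ρ`, with value `0` on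
the kernel of `ρ`. -/
theorem superCfc_isFinitelySupported (hσ : σ.PosSemidef) (hρ : ρ.PosSemidef) (X : Matrix n n ℂ) :
    IsFinitelySupported fun g => superCfc g (modular σ ρ) X := by
  obtain ⟨P, hP, hσP⟩ := exists_isResolution hσ.1
  obtain ⟨Q, hQ, hρQ⟩ := exists_isResolution hρ.1
  refine IsFinitelySupported.of_fintype
    (fun k : n × n => hσ.1.eigenvalues k.1 * (hρ.1.eigenvalues k.2)⁻¹)
    (fun k => P k.1 * X * Q k.2)
    (fun k => mul_nonneg (hσ.eigenvalues_nonneg _) (inv_nonneg.2 (hρ.eigenvalues_nonneg _)))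
    fun g => ?_
  conv_lhs => rw [hσP, hρQ]
  exact superCfc_modular_sum hP hQ _ _ g X

/-- On functions which factor through the quotient, the functional calculus of the relative modular
operator is multiplication from both sides. -/
theorem superCfc_modular_of_factor (hσ : σ.IsHermitian) (hρ : ρ.IsHermitian) {g p q : ℝ → ℝ}
    (h : ∀ i j, g (hσ.eigenvalues i * (hρ.eigenvalues j)⁻¹) =
      p (hσ.eigenvalues i) * q (hρ.eigenvalues j)) (X : Matrix n n ℂ) :
    superCfc g (modular σ ρ) X = cfc p σ * X * cfc q ρ := by
  obtain ⟨P, hP, hσP⟩ := exists_isResolution hσ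
  obtain ⟨Q, hQ, hρQ⟩ := exists_isResolution hρ
  conv_lhs => rw [hσP, hρQ]
  conv_rhs => rw [hσP, hρQ]
  rw [superCfc_modular_sum hP hQ, hP.cfc_sum, hQ.cfc_sum, Finset.sum_mul, Finset.sum_mul_sum,
    Fintype.sum_prod_type]
  refine Finset.sum_congr rfl fun i _ => Finset.sum_congr rfl fun j _ => ?_
  rw [h, Matrix.smul_mul, Matrix.smul_mul, Matrix.mul_smul, smul_smul, Complex.ofReal_mul]

theorem superCfc_one (hσ : σ.IsHermitian) (hρ : ρ.IsHermitian) (X : Matrix n n ℂ) :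
    superCfc (fun _ => 1) (modular σ ρ) X = X := by
  rw [superCfc_modular_of_factor hσ hρ (p := fun _ => 1) (q := fun _ => 1) (by simp),
    cfc_one_of_isHermitian hσ, cfc_one_of_isHermitian hρ, Matrix.one_mul, Matrix.mul_one]

theorem superCfc_id (hσ : σ.IsHermitian) (hρ : ρ.IsHermitian) (X : Matrix n n ℂ) :
    superCfc (fun x => x) (modular σ ρ) X = modular σ ρ X := by
  rw [superCfc_modular_of_factor hσ hρ (p := fun x => x) (q := fun x => x⁻¹) (by simp),
    cfc_id_of_isHermitian hσ, Matrix.mul_assoc]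
  rfl

theorem superCfc_rpow (hσ : σ.PosSemidef) (hρ : ρ.PosSemidef) (β : ℝ) (X : Matrix n n ℂ) :
    superCfc (fun x => x ^ β) (modular σ ρ) X = mpow σ β * X * mpow ρ (-β) :=
  superCfc_modular_of_factor hσ.1 hρ.1 (fun i j => by
    rw [Real.mul_rpow (hσ.eigenvalues_nonneg _) (inv_nonneg.2 (hρ.eigenvalues_nonneg _)),
      Real.inv_rpow (hρ.eigenvalues_nonneg _), Real.rpow_neg (hρ.eigenvalues_nonneg _)]) X

/-- For `σ` positive definite the modular operator has kernel only where `ρ` has. Applied to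
`ρ^{1/2}` this gives zero, so no mass sits at `0` and a singularity of `f` there is harmless. -/
theorem superCfc_indicator_zero (hσ : σ.PosDef) (hρ : ρ.IsHermitian) (X : Matrix n n ℂ) :
    superCfc (fun x => if x = 0 then 1 else 0) (modular σ ρ) X = X * (1 - supp ρ) := by
  rw [superCfc_modular_of_factor hσ.1 hρ (p := fun _ => 1) (q := fun x => 1 - if x = 0 then 0 else 1)
    (fun i j => by
      have := (hσ.eigenvalues_pos i).ne'
      by_cases h : hρ.eigenvalues j = 0 <;> simp [h, this]),
    cfc_one_of_isHermitian hσ.1, Matrix.one_mul, supp]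
  have hfin : ∀ k : ℝ → ℝ, ContinuousOn k (spectrum ℝ ρ) := fun k =>
    Matrix.finite_real_spectrum.continuousOn k
  rw [cfc_sub (fun _ => 1) _ ρ (hfin _) (hfin _), cfc_one_of_isHermitian hρ]

theorem superCfc_mul_cfc (hσ : σ.IsHermitian) (hρ : ρ.IsHermitian) (g h : ℝ → ℝ)
    (X : Matrix n n ℂ) :
    superCfc g (modular σ ρ) (X * cfc h ρ) = superCfc g (modular σ ρ) X * cfc h ρ := by
  obtain ⟨P, hP, hσP⟩ := exists_isResolution hσ
  obtain ⟨Q, hQ, hρQ⟩ := exists_isResolution hρ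
  have hcomm : ∀ j, cfc h ρ * Q j = Q j * cfc h ρ := by
    intro j
    rw [hρQ, hQ.cfc_sum]
    simp [Finset.sum_mul, Finset.mul_sum, hQ.mul]
  have hsum : ∀ Y, superCfc g (modular σ ρ) Y =
      ∑ k : n × n, (g (hσ.eigenvalues k.1 * (hρ.eigenvalues k.2)⁻¹) : ℂ) •
        (P k.1 * Y * Q k.2) := by
    intro Y
    conv_lhs => rw [hσP, hρQ]
    exact superCfc_modular_sum hP hQ _ _ g Y
  rw [hsum, hsum, Finset.sum_mul]
  refine Finset.sum_congr rfl fun k _ => ?_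
  simp only [Matrix.smul_mul, Matrix.mul_assoc, hcomm]

/-- The resolvent equation, checked on each joint eigenspace; it allows the gap to be computed by
pure algebra. -/
theorem modular_superCfc_resolvent (hσ : σ.PosSemidef) (hρ : ρ.PosSemidef) {t : ℝ} (ht : 0 < t)
    (X : Matrix n n ℂ) :
    (t : ℂ) • superCfc (fun x => 1 / (t + x)) (modular σ ρ) X +
      modular σ ρ (superCfc (fun x => 1 / (t + x)) (modular σ ρ) X) = X := by
  obtain ⟨P, hP, hσP⟩ := exists_isResolution hσ.1
  obtain ⟨Q, hQ, hρQ⟩ := exists_isResolution hρ.1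
  have hsum : ∀ g Y, superCfc g (modular σ ρ) Y =
      ∑ k : n × n, (g (hσ.1.eigenvalues k.1 * (hρ.1.eigenvalues k.2)⁻¹) : ℂ) •
        (P k.1 * Y * Q k.2) := by
    intro g Y
    conv_lhs => rw [hσP, hρQ]
    exact superCfc_modular_sum hP hQ _ _ g Y
  have hPQ : ∀ (k : n × n), modular σ ρ (P k.1 * X * Q k.2) =
      ((hσ.1.eigenvalues k.1 * (hρ.1.eigenvalues k.2)⁻¹ : ℝ) : ℂ) • (P k.1 * X * Q k.2) := by
    intro k
    have h1 : σ * P k.1 = (hσ.1.eigenvalues k.1 : ℂ) • P k.1 := by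
      conv_lhs => rw [hσP]
      simp [Finset.sum_mul, hP.mul]
    have h2 : Q k.2 * genInv ρ = (((hρ.1.eigenvalues k.2)⁻¹ : ℝ) : ℂ) • Q k.2 := by
      conv_lhs => rw [hρQ, hQ.genInv_sum]
      simp [Finset.mul_sum, hQ.mul]
    rw [modular_apply, Matrix.mul_assoc (P k.1 * X), h2, Matrix.mul_smul, Matrix.mul_smul,
      ← Matrix.mul_assoc, ← Matrix.mul_assoc, h1, Matrix.smul_mul, Matrix.smul_mul, smul_smul,
      Complex.ofReal_mul, mul_comm]
  conv_rhs => rw [← superCfc_one hσ.1 hρ.1 X]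
  rw [hsum, hsum, map_sum, Finset.smul_sum, ← Finset.sum_add_distrib]
  refine Finset.sum_congr rfl fun k _ => ?_
  rw [map_smul, hPQ, smul_smul, smul_smul, ← add_smul]
  congr 1
  have h0 : t + hσ.1.eigenvalues k.1 * (hρ.1.eigenvalues k.2)⁻¹ ≠ 0 := by
    have := mul_nonneg (hσ.eigenvalues_nonneg k.1) (inv_nonneg.2 (hρ.eigenvalues_nonneg k.2))
    positivity
  rw [← Complex.ofReal_mul, ← Complex.ofReal_mul, ← Complex.ofReal_add]
  congr 1
  generalize hσ.1.eigenvalues k.1 * (hρ.1.eigenvalues k.2)⁻¹ = c at h0 ⊢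
  field_simp

end Modular

end Calculus

/-! ### Monotonicity of quasi-entropies and its equality case -/

section Contraction

open Matrix

variable {m n : Type*} [Fintype m] [DecidableEq m] [Fintype n] [DecidableEq n]

/-- A contraction compatible with the relative modular operators of `(σ', ρ')` and `(σ, ρ)`, which
maps the vector `ρ' ^ (1 / 2)` to `ρ ^ (1 / 2)`. -/
structure IsModularContraction (σ ρ : Matrix n n ℂ) (σ' ρ' : Matrix m m ℂ)
    (V : Matrix m m ℂ →ₗ[ℂ] Matrix n n ℂ) : Prop where
  map_sqrt : V (mpow ρ' (1 / 2)) = mpow ρ (1 / 2)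
  inner_sqrt : ∀ y, hsInner (mpow ρ (1 / 2)) (V y) = hsInner (mpow ρ' (1 / 2)) y
  norm_le : ∀ y, (hsInner (V y) (V y)).re ≤ (hsInner y y).re
  energy_le : ∀ y, (hsInner (V y) (modular σ ρ (V y))).re ≤ (hsInner y (modular σ' ρ' y)).re

theorem superCfc_self {n : Type*} [Fintype n] [DecidableEq n] {A B : Matrix n n ℂ}
    (hA : A.IsHermitian) (hB : B.PosSemidef) (g : ℝ → ℝ) :
    superCfc g (modular A B) B = superCfc g (modular A B) (mpow B (1 / 2)) * mpow B (1 / 2) := by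
  have h : superCfc g (modular A B) (mpow B (1 / 2) * mpow B (1 / 2)) =
      superCfc g (modular A B) (mpow B (1 / 2)) * mpow B (1 / 2) :=
    superCfc_mul_cfc hA hB.1 g _ _
  rwa [mpow_half_mul_mpow_half hB] at h

/-- The quasi-entropy `⟨ρ ^ (1 / 2), g(L_σ R_ρ⁻¹) ρ ^ (1 / 2)⟩`. -/
def quasiEntropy (σ ρ : Matrix n n ℂ) (g : ℝ → ℝ) : ℂ :=
  hsInner (mpow ρ (1 / 2)) (superCfc g (modular σ ρ) (mpow ρ (1 / 2)))

theorem quasiEntropy_eq_trace {σ ρ : Matrix n n ℂ} (hσ : σ.IsHermitian) (hρ : ρ.PosSemidef)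
    (g : ℝ → ℝ) : quasiEntropy σ ρ g = (superCfc g (modular σ ρ) ρ).trace := by
  rw [superCfc_self hσ hρ, quasiEntropy, hsInner, conjTranspose_mpow, trace_mul_comm]

theorem quasiEntropy_isFinitelySupported {σ ρ : Matrix n n ℂ} (hσ : σ.PosSemidef)
    (hρ : ρ.PosSemidef) : IsFinitelySupported (quasiEntropy σ ρ) :=
  (superCfc_isFinitelySupported hσ hρ (mpow ρ (1 / 2))).map (hsInnerLinear (mpow ρ (1 / 2)))

namespace IsModularContraction

variable {σ ρ : Matrix n n ℂ} {σ' ρ' : Matrix m m ℂ} {V : Matrix m m ℂ →ₗ[ℂ] Matrix n n ℂ}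

/-- The gap in the monotonicity of the resolvent quasi-entropies. -/
theorem resolvent_gap (hV : IsModularContraction σ ρ σ' ρ' V) (hσ : σ.PosSemidef)
    (hρ : ρ.PosSemidef) (hσ' : σ'.PosSemidef) (hρ' : ρ'.PosSemidef) {t : ℝ} (ht : 0 < t)
    {x : Matrix n n ℂ} {y : Matrix m m ℂ}
    (hx : x = superCfc (fun r => 1 / (t + r)) (modular σ ρ) (mpow ρ (1 / 2)))
    (hy : y = superCfc (fun r => 1 / (t + r)) (modular σ' ρ') (mpow ρ' (1 / 2))) :
    t * (hsInner (x - V y) (x - V y)).re +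
      ((hsInner y (modular σ' ρ' y)).re - (hsInner (V y) (modular σ ρ (V y))).re) ≤
    (quasiEntropy σ ρ fun r => 1 / (t + r)).re - (quasiEntropy σ' ρ' fun r => 1 / (t + r)).re := by
  have hv : (t : ℂ) • x + modular σ ρ x = mpow ρ (1 / 2) := by
    rw [hx, modular_superCfc_resolvent hσ hρ ht]
  have hu : (t : ℂ) • y + modular σ' ρ' y = mpow ρ' (1 / 2) := by
    rw [hy, modular_superCfc_resolvent hσ' hρ' ht]
  rw [quasiEntropy, quasiEntropy, ← hx, ← hy]
  set v := mpow ρ (1 / 2)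
  set u := mpow ρ' (1 / 2)
  set w := V y
  -- With `q(z) = t ‖z‖² + ⟨z, Δ z⟩` and `q'` its counterpart for `(σ', ρ')`, this identity gives
  -- `⟨v, x⟩ - ⟨u, y⟩ = q(x - w) + q'(y) - q(w)` in real parts. The bound follows by dropping the
  -- energy of `x - w` and using `‖w‖ ≤ ‖y‖`.
  have h1 : hsInner v w = hsInner u y := hV.inner_sqrt y
  have h2 : (hsInner u y).re = t * (hsInner y y).re + (hsInner y (modular σ' ρ' y)).re := by
    rw [re_hsInner_comm, ← hu, hsInner_add_right, hsInner_smul_right]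
    simp
  have h3 : (hsInner v w).re = t * (hsInner x w).re + (hsInner x (modular σ ρ w)).re := by
    rw [re_hsInner_comm, ← hv, hsInner_add_right, hsInner_smul_right, re_hsInner_comm x w,
      re_hsInner_comm x, hsInner_modular_left hσ.1]
    simp
  have h4 : (hsInner v x).re = t * (hsInner x x).re + (hsInner x (modular σ ρ x)).re := by
    rw [re_hsInner_comm, ← hv, hsInner_add_right, hsInner_smul_right]
    simp
  have h5 := re_hsInner_modular_nonneg hσ hρ (x - w)
  have h6 : (hsInner w (modular σ ρ x)).re = (hsInner x (modular σ ρ w)).re := by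
    rw [re_hsInner_comm, hsInner_modular_left hσ.1]
  have h7 := re_hsInner_comm w x
  have h8 := mul_le_mul_of_nonneg_left (hV.norm_le y) ht.le
  rw [map_sub] at h5
  simp only [hsInner_sub_left, hsInner_sub_right, Complex.sub_re, ← h1] at *
  rw [h6] at h5
  rw [h7]
  linarith

theorem quasiEntropy_resolvent_le (hV : IsModularContraction σ ρ σ' ρ' V) (hσ : σ.PosSemidef)
    (hρ : ρ.PosSemidef) (hσ' : σ'.PosSemidef) (hρ' : ρ'.PosSemidef) {t : ℝ} (ht : 0 < t) :
    (quasiEntropy σ' ρ' fun r => 1 / (t + r)).re ≤ (quasiEntropy σ ρ fun r => 1 / (t + r)).re := by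
  have h1 := hV.resolvent_gap hσ hρ hσ' hρ' ht rfl rfl
  have h2 := hV.energy_le (superCfc (fun r => 1 / (t + r)) (modular σ' ρ') (mpow ρ' (1 / 2)))
  have h3 := mul_nonneg ht.le (re_hsInner_self_nonneg
    (superCfc (fun r => 1 / (t + r)) (modular σ ρ) (mpow ρ (1 / 2)) -
      V (superCfc (fun r => 1 / (t + r)) (modular σ' ρ') (mpow ρ' (1 / 2)))))
  linarith

/-- Both terms of the gap are nonnegative, so both vanish. The first gives the intertwining, the
second the equality of energies used later to compare supports. -/
theorem resolvent_eq (hV : IsModularContraction σ ρ σ' ρ' V) (hσ : σ.PosSemidef)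
    (hρ : ρ.PosSemidef) (hσ' : σ'.PosSemidef) (hρ' : ρ'.PosSemidef) {t : ℝ} (ht : 0 < t)
    (h : (quasiEntropy σ ρ fun r => 1 / (t + r)).re ≤
      (quasiEntropy σ' ρ' fun r => 1 / (t + r)).re) {y : Matrix m m ℂ}
    (hy : y = superCfc (fun r => 1 / (t + r)) (modular σ' ρ') (mpow ρ' (1 / 2))) :
    superCfc (fun r => 1 / (t + r)) (modular σ ρ) (mpow ρ (1 / 2)) = V y ∧
      (hsInner y (modular σ' ρ' y)).re ≤ (hsInner (V y) (modular σ ρ (V y))).re := by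
  have h1 := hV.resolvent_gap hσ hρ hσ' hρ' ht rfl hy
  have h2 := hV.energy_le y
  have h3 := re_hsInner_self_nonneg
    (superCfc (fun r => 1 / (t + r)) (modular σ ρ) (mpow ρ (1 / 2)) - V y)
  have h4 := mul_nonneg ht.le h3
  refine ⟨sub_eq_zero.1 (eq_zero_of_re_hsInner_self_nonpos ?_), by linarith⟩
  refine nonpos_of_mul_nonpos_right (by linarith) ht

/-- If the resolvent quasi-entropies agree, then `V` intertwines all functions of the relative
modular operators on the square root. -/
theorem intertwine (hV : IsModularContraction σ ρ σ' ρ' V) (hσ : σ.PosSemidef)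
    (hρ : ρ.PosSemidef) (hσ' : σ'.PosSemidef) (hρ' : ρ'.PosSemidef)
    (h : ∀ t, 0 < t → (quasiEntropy σ ρ fun r => 1 / (t + r)).re ≤
      (quasiEntropy σ' ρ' fun r => 1 / (t + r)).re) (g : ℝ → ℝ) :
    superCfc g (modular σ ρ) (mpow ρ (1 / 2)) =
      V (superCfc g (modular σ' ρ') (mpow ρ' (1 / 2))) := by
  refine sub_eq_zero.1 (IsFinitelySupported.eq_zero_of_resolvent
    ((superCfc_isFinitelySupported hσ hρ (mpow ρ (1 / 2))).sub
      ((superCfc_isFinitelySupported hσ' hρ' (mpow ρ' (1 / 2))).map V))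
    (Set.Ioi_infinite (0 : ℝ)) subset_rfl (fun t ht => ?_) g)
  exact sub_eq_zero.2 (hV.resolvent_eq hσ hρ hσ' hρ' ht (h t ht) rfl).1

/-- Equality of the quasi-entropies of one regular function implies equality for all functions. -/
theorem quasiEntropy_eq_of_isRegular (hV : IsModularContraction σ ρ σ' ρ' V)
    (hσ : σ.PosSemidef) (hρ : ρ.PosSemidef) (hσ' : σ'.PosSemidef) (hρ' : ρ'.PosSemidef)
    {f : ℝ → ℝ} (hf : IsRegular f)
    (hzero : (σ.PosDef ∧ σ'.PosDef) ∨ Filter.Tendsto f (𝓝[>] 0) (𝓝 (f 0)))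
    (h : quasiEntropy σ ρ f = quasiEntropy σ' ρ' f) (g : ℝ → ℝ) :
    (quasiEntropy σ ρ g).re = (quasiEntropy σ' ρ' g).re := by
  have key := IsFinitelySupported.re_eq_zero_of_isRegular hf
    ((quasiEntropy_isFinitelySupported hσ hρ).sub (quasiEntropy_isFinitelySupported hσ' hρ'))
    ?_ ?_ ?_ (hzero.imp_left ?_) (by simp [h]) g
  · simpa [sub_eq_zero] using key
  · rw [quasiEntropy, quasiEntropy, superCfc_one hσ.1 hρ.1, superCfc_one hσ'.1 hρ'.1,
      ← hV.inner_sqrt, hV.map_sqrt, sub_self, Complex.zero_re]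
  · rw [quasiEntropy, quasiEntropy, superCfc_id hσ.1 hρ.1, superCfc_id hσ'.1 hρ'.1]
    have := hV.energy_le (mpow ρ' (1 / 2))
    rw [hV.map_sqrt] at this
    rw [Complex.sub_re]
    linarith
  · intro t ht
    rw [Complex.sub_re]
    exact sub_nonneg.2 (hV.quasiEntropy_resolvent_le hσ hρ hσ' hρ' ht)
  · rintro ⟨h1, h2⟩
    rw [quasiEntropy, quasiEntropy, superCfc_indicator_zero h1 hρ.1,
      superCfc_indicator_zero h2 hρ'.1]
    simp [Matrix.mul_sub, mpow_mul_supp, hsInner]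

end IsModularContraction

end Contraction

/-! ### The contraction attached to the partial trace, and supports -/

section PartialTrace

open Matrix

variable {a m : Type*} [Fintype a] [DecidableEq a] [Fintype m] [DecidableEq m]

section PartialTrace

theorem trFst_mul_one_kronecker (M : Matrix (a × m) (a × m) ℂ) (X : Matrix m m ℂ) :
    trFst (M * ((1 : Matrix a a ℂ) ⊗ₖ X)) = trFst M * X := by
  ext i j
  simp only [trFst, of_apply, Matrix.mul_apply, kroneckerMap_apply, Fintype.sum_prod_type_right,
    Matrix.one_apply, Finset.sum_mul]
  rw [Finset.sum_comm]
  simp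

theorem trFst_one_kronecker_mul (M : Matrix (a × m) (a × m) ℂ) (X : Matrix m m ℂ) :
    trFst (((1 : Matrix a a ℂ) ⊗ₖ X) * M) = X * trFst M := by
  ext i j
  simp only [trFst, of_apply, Matrix.mul_apply, kroneckerMap_apply, Fintype.sum_prod_type_right,
    Matrix.one_apply, Finset.mul_sum]
  rw [Finset.sum_comm]
  simp

theorem trace_trFst (M : Matrix (a × m) (a × m) ℂ) : (trFst M).trace = M.trace := by
  simp only [trFst, trace, diag_apply, of_apply, Fintype.sum_prod_type]
  exact Finset.sum_comm

theorem trFst_posSemidef {M : Matrix (a × m) (a × m) ℂ} (hM : M.PosSemidef) :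
    (trFst M).PosSemidef := by
  have : trFst M = ∑ k, M.submatrix (fun i => (k, i)) (fun i => (k, i)) := by
    ext i j
    simp [trFst, Matrix.sum_apply]
  rw [this]
  exact posSemidef_sum _ fun k _ => hM.submatrix _

theorem trFst_posDef [Nonempty a] {M : Matrix (a × m) (a × m) ℂ} (hM : M.PosDef) :
    (trFst M).PosDef := by
  have : trFst M = ∑ k, M.submatrix (fun i => (k, i)) (fun i => (k, i)) := by
    ext i j
    simp [trFst, Matrix.sum_apply]
  obtain ⟨k₀⟩ := ‹Nonempty a›
  rw [this, ← Finset.add_sum_erase _ _ (Finset.mem_univ k₀)]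
  exact (hM.submatrix (Prod.mk_right_injective k₀)).add_posSemidef
    (posSemidef_sum _ fun k _ => hM.posSemidef.submatrix _)

/-- The partial trace as a linear map. -/
def trFstLinear : Matrix (a × m) (a × m) ℂ →ₗ[ℂ] Matrix m m ℂ where
  toFun := trFst
  map_add' X Y := by ext i j; simp [trFst, Finset.sum_add_distrib]
  map_smul' r X := by ext i j; simp [trFst, Finset.mul_sum]

theorem one_kronecker_mul (X Y : Matrix m m ℂ) :
    (1 : Matrix a a ℂ) ⊗ₖ (X * Y) = ((1 : Matrix a a ℂ) ⊗ₖ X) * ((1 : Matrix a a ℂ) ⊗ₖ Y) := by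
  rw [← mul_kronecker_mul, Matrix.one_mul]

theorem conjTranspose_one_kronecker (X : Matrix m m ℂ) :
    ((1 : Matrix a a ℂ) ⊗ₖ X)ᴴ = (1 : Matrix a a ℂ) ⊗ₖ Xᴴ := by
  rw [conjTranspose_kronecker, conjTranspose_one]

end PartialTrace

theorem hsInner_mul_projection {n : Type*} [Fintype n] [DecidableEq n] {p : Matrix n n ℂ}
    (hp : pᴴ = p) (hpp : p * p = p) (X : Matrix n n ℂ) :
    hsInner (X * p) (X * p) + hsInner (X * (1 - p)) (X * (1 - p)) = hsInner X X := by
  have h : ∀ q : Matrix n n ℂ, qᴴ = q → q * q = q → hsInner (X * q) (X * q) = (q * (Xᴴ * X)).trace := by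
    intro q hq hqq
    rw [hsInner, conjTranspose_mul, hq, trace_mul_comm, Matrix.mul_assoc, ← Matrix.mul_assoc q, hqq,
      trace_mul_comm, Matrix.mul_assoc]
  rw [h p hp hpp, h (1 - p) (by simp [hp]) (by simp [Matrix.mul_sub, Matrix.sub_mul, hpp]),
    ← trace_add, ← add_mul, add_sub_cancel, Matrix.one_mul, hsInner]

variable {ρ Γ : Matrix (a × m) (a × m) ℂ}

/-- The support of `ρ` lies inside that of `I ⊗ ρ₂`: for `q = 1 - supp ρ₂` the squared norm of
`ρ^{1/2} (I ⊗ q)` is `Tr (q ρ₂ q) = 0`. -/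
theorem mpow_half_mul_supp_trFst (hρ : ρ.PosSemidef) :
    mpow ρ (1 / 2) * ((1 : Matrix a a ℂ) ⊗ₖ supp (trFst ρ)) = mpow ρ (1 / 2) := by
  have hρ' := trFst_posSemidef hρ
  have h0 : trFst ρ * (1 - supp (trFst ρ)) = 0 := by
    have := mpow_mul_supp (trFst ρ) one_ne_zero
    rw [mpow_one hρ'.1] at this
    rw [Matrix.mul_sub, this, Matrix.mul_one, sub_self]
  have h1 : mpow ρ (1 / 2) * ((1 : Matrix a a ℂ) ⊗ₖ (1 - supp (trFst ρ))) = 0 := by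
    rw [← trace_conjTranspose_mul_self_eq_zero_iff, conjTranspose_mul, conjTranspose_mpow,
      Matrix.mul_assoc, ← Matrix.mul_assoc (mpow ρ (1 / 2)), mpow_half_mul_mpow_half hρ,
      conjTranspose_one_kronecker, ← trace_trFst, trFst_one_kronecker_mul, trFst_mul_one_kronecker,
      h0, Matrix.mul_zero, trace_zero]
  have h2 : (1 : Matrix a a ℂ) ⊗ₖ (1 - supp (trFst ρ)) =
      1 - (1 : Matrix a a ℂ) ⊗ₖ supp (trFst ρ) := by
    rw [eq_sub_iff_add_eq, ← kronecker_add, sub_add_cancel, one_kronecker_one]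
  rw [h2, Matrix.mul_sub, Matrix.mul_one, sub_eq_zero] at h1
  exact h1.symm

theorem supp_trFst_mul_mpow_half (hρ : ρ.PosSemidef) :
    ((1 : Matrix a a ℂ) ⊗ₖ supp (trFst ρ)) * mpow ρ (1 / 2) = mpow ρ (1 / 2) := by
  simpa [conjTranspose_mul, conjTranspose_mpow, conjTranspose_one_kronecker, conjTranspose_supp]
    using congrArg conjTranspose (mpow_half_mul_supp_trFst hρ)

/-- The contraction `y ↦ (I ⊗ y ρ₂ ^ (-1/2)) ρ ^ (1/2)` associated to the partial trace. -/
def stateEmbedding (ρ : Matrix (a × m) (a × m) ℂ) :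
    Matrix m m ℂ →ₗ[ℂ] Matrix (a × m) (a × m) ℂ where
  toFun y := ((1 : Matrix a a ℂ) ⊗ₖ (y * mpow (trFst ρ) (-(1 / 2)))) * mpow ρ (1 / 2)
  map_add' x y := by rw [add_mul, kronecker_add, add_mul]
  map_smul' r x := by rw [smul_mul, kronecker_smul, smul_mul, RingHom.id_apply]

theorem stateEmbedding_apply (ρ : Matrix (a × m) (a × m) ℂ) (y : Matrix m m ℂ) :
    stateEmbedding ρ y =
      ((1 : Matrix a a ℂ) ⊗ₖ (y * mpow (trFst ρ) (-(1 / 2)))) * mpow ρ (1 / 2) := rfl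

/-- The energy of an embedded vector. -/
theorem energy_stateEmbedding (hρ : ρ.PosSemidef) (hΓ : Γ.PosSemidef) (y : Matrix m m ℂ) :
    hsInner (stateEmbedding ρ y) (modular Γ ρ (stateEmbedding ρ y)) +
      hsInner
        (mpow Γ (1 / 2) * ((1 : Matrix a a ℂ) ⊗ₖ (y * mpow (trFst ρ) (-(1 / 2)))) * (1 - supp ρ))
        (mpow Γ (1 / 2) * ((1 : Matrix a a ℂ) ⊗ₖ (y * mpow (trFst ρ) (-(1 / 2)))) * (1 - supp ρ)) =
      hsInner y (modular (trFst Γ) (trFst ρ) y) := by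
  have hρ' := trFst_posSemidef hρ
  have hΓ' := trFst_posSemidef hΓ
  -- In the energy of `V y` the product `ρ^{1/2} ρ^{-1/2}` leaves `supp ρ`; the second summand is
  -- the Pythagorean complement.
  rw [hsInner_modular_self hΓ hρ, stateEmbedding_apply, ← Matrix.mul_assoc (mpow Γ (1 / 2)),
    Matrix.mul_assoc _ (mpow ρ (1 / 2)), mpow_mul_mpow_neg hρ (by norm_num),
    hsInner_mul_projection (conjTranspose_supp ρ) (supp_mul_supp ρ), hsInner_modular_self hΓ' hρ',
    Matrix.mul_assoc]
  set z := y * mpow (trFst ρ) (-(1 / 2))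
  rw [hsInner, hsInner, conjTranspose_mul, conjTranspose_mul, conjTranspose_mpow,
    conjTranspose_mpow, Matrix.mul_assoc, ← Matrix.mul_assoc (mpow Γ (1 / 2)),
    mpow_half_mul_mpow_half hΓ, Matrix.mul_assoc, ← Matrix.mul_assoc (mpow (trFst Γ) (1 / 2)),
    mpow_half_mul_mpow_half hΓ', conjTranspose_one_kronecker, ← trace_trFst,
    trFst_one_kronecker_mul, trFst_mul_one_kronecker]

theorem stateEmbedding_sqrt (hρ : ρ.PosSemidef) :
    stateEmbedding ρ (mpow (trFst ρ) (1 / 2)) = mpow ρ (1 / 2) := by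
  rw [stateEmbedding_apply, mpow_mul_mpow_neg (trFst_posSemidef hρ) (by norm_num),
    supp_trFst_mul_mpow_half hρ]

theorem mpow_neg_half_mul_self {n : Type*} [Fintype n] [DecidableEq n] {A : Matrix n n ℂ}
    (hA : A.PosSemidef) : mpow A (-(1 / 2)) * A = mpow A (1 / 2) := by
  have h := mpow_mul_mpow hA (r := -(1 / 2)) (s := 1) (by norm_num)
  rw [mpow_one hA.1] at h
  rw [h]
  norm_num

/-- `‖V y‖ = ‖y supp ρ₂‖`, and the energy loss is the explicit square in `energy_stateEmbedding`. -/
theorem isModularContraction_stateEmbedding (hρ : ρ.PosSemidef) (hΓ : Γ.PosSemidef) :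
    IsModularContraction Γ ρ (trFst Γ) (trFst ρ) (stateEmbedding ρ) where
  map_sqrt := stateEmbedding_sqrt hρ
  inner_sqrt y := by
    have hρ' := trFst_posSemidef hρ
    rw [hsInner, hsInner, conjTranspose_mpow, conjTranspose_mpow, stateEmbedding_apply,
      trace_mul_comm, Matrix.mul_assoc, mpow_half_mul_mpow_half hρ, ← trace_trFst,
      trFst_one_kronecker_mul, Matrix.mul_assoc, mpow_neg_half_mul_self hρ', trace_mul_comm]
  norm_le y := by
    have hρ' := trFst_posSemidef hρ
    have h1 : hsInner (stateEmbedding ρ y) (stateEmbedding ρ y) =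
        hsInner (y * supp (trFst ρ)) (y * supp (trFst ρ)) := by
      rw [hsInner, hsInner, stateEmbedding_apply, conjTranspose_mul, conjTranspose_mpow,
        Matrix.mul_assoc, trace_mul_comm, Matrix.mul_assoc, Matrix.mul_assoc,
        mpow_half_mul_mpow_half hρ, conjTranspose_one_kronecker, ← trace_trFst,
        trFst_one_kronecker_mul, trFst_one_kronecker_mul, Matrix.mul_assoc y,
        mpow_neg_half_mul_self hρ', conjTranspose_mul, conjTranspose_mpow, conjTranspose_mul,
        conjTranspose_supp, Matrix.mul_assoc, trace_mul_comm, Matrix.mul_assoc (supp _),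
        trace_mul_comm (supp _)]
      simp only [Matrix.mul_assoc]
      rw [mpow_mul_mpow_neg hρ' (by norm_num), supp_mul_supp]
    rw [h1, ← hsInner_mul_projection (conjTranspose_supp (trFst ρ)) (supp_mul_supp _) y,
      Complex.add_re]
    linarith [re_hsInner_self_nonneg (y * (1 - supp (trFst ρ)))]
  energy_le y := by
    rw [← energy_stateEmbedding hρ hΓ, Complex.add_re]
    linarith [re_hsInner_self_nonneg (mpow Γ (1 / 2) *
      ((1 : Matrix a a ℂ) ⊗ₖ (y * mpow (trFst ρ) (-(1 / 2)))) * (1 - supp ρ))]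

/-- If the resolvent quasi-entropies agree and `Γ` is positive definite, then the support of `ρ` is
that of its reduction. -/
theorem supp_trFst_eq (hρ : ρ.PosSemidef) (hΓ : Γ.PosDef)
    (h : ∀ t, 0 < t → (quasiEntropy Γ ρ fun r => 1 / (t + r)).re ≤
      (quasiEntropy (trFst Γ) (trFst ρ) fun r => 1 / (t + r)).re) :
    (1 : Matrix a a ℂ) ⊗ₖ supp (trFst ρ) = supp ρ := by
  have hρ' := trFst_posSemidef hρ
  have hΓ' := trFst_posSemidef hΓ.posSemidef
  have hinv : mpow Γ (-(1 / 2)) * mpow Γ (1 / 2) = 1 := by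
    rw [mpow_neg_mul_mpow hΓ.posSemidef (by norm_num), supp_eq_one hΓ]
  -- `Φ` is the energy defect with the invertible factor `Γ^{1/2}` removed. Equality of energies
  -- annihilates it on every resolvent vector, hence, by separation, on `ρ₂^{1/2}` itself.
  let Φ : Matrix m m ℂ →ₗ[ℂ] Matrix (a × m) (a × m) ℂ :=
    { toFun := fun y => ((1 : Matrix a a ℂ) ⊗ₖ (y * mpow (trFst ρ) (-(1 / 2)))) * (1 - supp ρ)
      map_add' := fun x y => by rw [add_mul, kronecker_add, add_mul]
      map_smul' := fun r x => by rw [smul_mul, kronecker_smul, smul_mul, RingHom.id_apply] }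
  have hΦ := IsFinitelySupported.eq_zero_of_resolvent
    ((superCfc_isFinitelySupported hΓ' hρ' (mpow (trFst ρ) (1 / 2))).map Φ)
    (Set.Ioi_infinite (0 : ℝ)) subset_rfl (fun t ht => ?_) (fun _ => 1)
  · rw [superCfc_one hΓ'.1 hρ'.1] at hΦ
    have h1 : ((1 : Matrix a a ℂ) ⊗ₖ supp (trFst ρ)) * (1 - supp ρ) = 0 := by
      rw [← mpow_mul_mpow_neg hρ' (r := 1 / 2) (by norm_num)]
      exact hΦ
    have h2 : ((1 : Matrix a a ℂ) ⊗ₖ supp (trFst ρ)) * supp ρ = supp ρ := by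
      rw [← mpow_mul_mpow_neg hρ (r := 1 / 2) (by norm_num), ← Matrix.mul_assoc,
        supp_trFst_mul_mpow_half hρ]
    rw [Matrix.mul_sub, h2, Matrix.mul_one] at h1
    exact sub_eq_zero.1 h1
  · set y := superCfc (fun r => 1 / (t + r)) (modular (trFst Γ) (trFst ρ)) (mpow (trFst ρ) (1 / 2))
    have h1 := ((isModularContraction_stateEmbedding hρ hΓ.posSemidef).resolvent_eq hΓ.posSemidef hρ
      hΓ' hρ' ht (h t ht) (y := y) rfl).2
    rw [← energy_stateEmbedding hρ hΓ.posSemidef, Complex.add_re] at h1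
    have h2 := eq_zero_of_re_hsInner_self_nonpos (by linarith)
    have h3 := congrArg (mpow Γ (-(1 / 2)) * ·) h2
    simp only [Matrix.mul_zero] at h3
    rwa [← Matrix.mul_assoc, ← Matrix.mul_assoc, hinv, Matrix.one_mul] at h3

/-! ### The reverse contraction under Petz recovery -/

/-- The map `X ↦ ρ₂ ^ (-1/2) Tr₁ (ρ ^ (1/2) X)` associated to the Petz recovery map. -/
def petzEmbedding (ρ : Matrix (a × m) (a × m) ℂ) :
    Matrix (a × m) (a × m) ℂ →ₗ[ℂ] Matrix m m ℂ where
  toFun X := mpow (trFst ρ) (-(1 / 2)) * trFst (mpow ρ (1 / 2) * X)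
  map_add' x y := by
    have h : trFst (mpow ρ (1 / 2) * x + mpow ρ (1 / 2) * y) = _ := map_add trFstLinear _ _
    rw [Matrix.mul_add, h, Matrix.mul_add]
    rfl
  map_smul' r x := by
    have h : trFst (r • (mpow ρ (1 / 2) * x)) = _ := map_smul trFstLinear r _
    rw [Matrix.mul_smul, h, Matrix.mul_smul]
    rfl

/-- The map is the adjoint of the isometry `C ↦ ρ^{1/2} (I ⊗ ρ₂^{-1/2} C)`, so it contracts norms.
Inserting the recovered form of `Γ` into the energy makes a similar projection argument work there.
-/
theorem isModularContraction_petzEmbedding [Nonempty a] (hρ : ρ.PosDef) (hΓ : Γ.PosSemidef)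
    (hpetz : petz ρ (trFst Γ) = Γ) :
    IsModularContraction (trFst Γ) (trFst ρ) Γ ρ (petzEmbedding ρ) where
  map_sqrt := by
    change mpow (trFst ρ) (-(1 / 2)) * trFst (mpow ρ (1 / 2) * mpow ρ (1 / 2)) = _
    rw [mpow_half_mul_mpow_half hρ.posSemidef,
      mpow_neg_half_mul_self (trFst_posSemidef hρ.posSemidef)]
  inner_sqrt y := by
    have hρ' := trFst_posDef hρ
    change hsInner _ (mpow (trFst ρ) (-(1 / 2)) * trFst (mpow ρ (1 / 2) * y)) = _
    rw [hsInner, hsInner, conjTranspose_mpow, conjTranspose_mpow, ← Matrix.mul_assoc,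
      mpow_mul_mpow_neg hρ'.posSemidef (by norm_num), supp_eq_one hρ', Matrix.one_mul, trace_trFst]
  norm_le y := by
    have hρ' := trFst_posDef hρ
    set C := petzEmbedding ρ y with hC
    set s := mpow (trFst ρ) (-(1 / 2)) with hs
    set R := mpow ρ (1 / 2) with hR
    have hsρs : s * trFst ρ * s = 1 := by
      rw [mpow_neg_half_mul_self hρ'.posSemidef, mpow_mul_mpow_neg hρ'.posSemidef (by norm_num),
        supp_eq_one hρ']
    -- `K` is the orthogonal projection of `y` onto the range of that isometry; `‖y - K‖² ≥ 0` is
    -- the claim.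
    set K := R * ((1 : Matrix a a ℂ) ⊗ₖ (s * C)) with hK
    have hKH : Kᴴ = ((1 : Matrix a a ℂ) ⊗ₖ (Cᴴ * s)) * R := by
      rw [conjTranspose_mul, conjTranspose_one_kronecker, conjTranspose_mul, conjTranspose_mpow,
        conjTranspose_mpow]
    have h1 : hsInner K y = hsInner C C := by
      rw [hsInner, hKH, Matrix.mul_assoc, ← trace_trFst, trFst_one_kronecker_mul, Matrix.mul_assoc]
      rfl
    have h2 : hsInner K K = hsInner C C := by
      rw [hsInner, hKH, hK, Matrix.mul_assoc, ← Matrix.mul_assoc R,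
        mpow_half_mul_mpow_half hρ.posSemidef, ← trace_trFst, trFst_one_kronecker_mul,
        trFst_mul_one_kronecker]
      have : Cᴴ * s * (trFst ρ * (s * C)) = Cᴴ * ((s * trFst ρ * s) * C) := by
        simp only [Matrix.mul_assoc]
      rw [this, hsρs, Matrix.one_mul, hsInner]
    have h3 := re_hsInner_self_nonneg (y - K)
    simp only [hsInner_sub_left, hsInner_sub_right, Complex.sub_re] at h3
    rw [re_hsInner_comm y K, h1, h2] at h3
    linarith
  energy_le y := by
    have hρ' := trFst_posDef hρ
    have hΓ' := trFst_posSemidef hΓ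
    rw [hsInner_modular_self hΓ' hρ'.posSemidef]
    have hC : petzEmbedding ρ y = mpow (trFst ρ) (-(1 / 2)) * trFst (mpow ρ (1 / 2) * y) := rfl
    set C := petzEmbedding ρ y
    set s := mpow (trFst ρ) (-(1 / 2)) with hs
    set R := mpow ρ (1 / 2) with hR
    set S := mpow (trFst Γ) (1 / 2) with hS
    have hsρs : s * trFst ρ * s = 1 := by
      rw [mpow_neg_half_mul_self hρ'.posSemidef, mpow_mul_mpow_neg hρ'.posSemidef (by norm_num),
        supp_eq_one hρ']
    have hsH : sᴴ = s := conjTranspose_mpow _ _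
    have hRH : Rᴴ = R := conjTranspose_mpow _ _
    have hSH : Sᴴ = S := conjTranspose_mpow _ _
    have hRR : R * R = ρ := mpow_half_mul_mpow_half hρ.posSemidef
    set Ri := mpow ρ (-(1 / 2)) with hRi
    have hRiR : Ri * R = 1 := by
      rw [mpow_neg_mul_mpow hρ.posSemidef (by norm_num), supp_eq_one hρ]
    have hRiH : Riᴴ = Ri := conjTranspose_mpow _ _
    -- By the recovery condition the energy of `y` is `‖G‖²`. The matrix `M` satisfies `⟨M, G⟩ =
    -- ‖M‖²`, equal to the energy of `C`, so `‖G - M‖² ≥ 0` compares the two.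
    set G := ((1 : Matrix a a ℂ) ⊗ₖ (S * s)) * R * y * Ri with hG
    set M := ((1 : Matrix a a ℂ) ⊗ₖ (S * C * s * s)) * R with hM
    have hMH : Mᴴ = R * ((1 : Matrix a a ℂ) ⊗ₖ (s * (S * C * s)ᴴ)) := by
      rw [hM, conjTranspose_mul, conjTranspose_one_kronecker, conjTranspose_mul, hsH, hRH]
    have h1 : hsInner y (modular Γ ρ y) = hsInner G G := by
      rw [modular_apply, genInv_eq hρ.posSemidef]
      conv_lhs => rw [← hpetz]
      rw [petz, ← mpow_half_mul_mpow_half hΓ', hsInner, hsInner, hG]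
      simp only [conjTranspose_mul, conjTranspose_one_kronecker, hsH, hRH, hSH, hRiH]
      rw [Matrix.mul_assoc Ri, trace_mul_comm Ri]
      simp only [one_kronecker_mul, Matrix.mul_assoc]
      rfl
    have h2 : hsInner M G = hsInner (S * C * s) (S * C * s) := by
      rw [hsInner, hMH, hG, Matrix.mul_assoc R, trace_mul_comm R]
      have : ((1 : Matrix a a ℂ) ⊗ₖ (s * (S * C * s)ᴴ)) *
          (((1 : Matrix a a ℂ) ⊗ₖ (S * s)) * R * y * Ri) * R =
          ((1 : Matrix a a ℂ) ⊗ₖ (s * (S * C * s)ᴴ * (S * s))) * (R * y) := by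
        rw [one_kronecker_mul _ (S * s)]
        simp only [Matrix.mul_assoc, hRiR, Matrix.mul_one]
      rw [this, ← trace_trFst, trFst_one_kronecker_mul]
      have : s * (S * C * s)ᴴ * (S * s) * trFst (R * y) = s * ((S * C * s)ᴴ * (S * C)) := by
        rw [hC]
        simp only [Matrix.mul_assoc]
      rw [this, trace_mul_comm, Matrix.mul_assoc, hsInner]
    have h3 : hsInner M M = hsInner (S * C * s) (S * C * s) := by
      rw [hsInner, hMH, hM, trace_mul_comm]
      have : ((1 : Matrix a a ℂ) ⊗ₖ (S * C * s * s)) * R *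
          (R * ((1 : Matrix a a ℂ) ⊗ₖ (s * (S * C * s)ᴴ))) =
          ((1 : Matrix a a ℂ) ⊗ₖ (S * C * s * s)) *
            (ρ * ((1 : Matrix a a ℂ) ⊗ₖ (s * (S * C * s)ᴴ))) := by
        rw [← hRR]
        simp only [Matrix.mul_assoc]
      rw [this, ← trace_trFst, trFst_one_kronecker_mul, trFst_mul_one_kronecker]
      have : S * C * s * s * (trFst ρ * (s * (S * C * s)ᴴ)) =
          S * C * s * (s * trFst ρ * s) * (S * C * s)ᴴ := by
        simp only [Matrix.mul_assoc]
      rw [this, hsρs, Matrix.mul_one, trace_mul_comm, hsInner]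
    have h4 := re_hsInner_self_nonneg (G - M)
    simp only [hsInner_sub_left, hsInner_sub_right, Complex.sub_re] at h4
    rw [re_hsInner_comm G M, h2, h3, ← h1] at h4
    linarith

end PartialTrace

/-! ### Equality, intertwining, powers and Petz recovery -/

section RuskaiEquality

open Matrix

section Equivalences

variable {a m : Type*} [Fintype a] [DecidableEq a] [Fintype m] [DecidableEq m]
  {ρ Γ : Matrix (a × m) (a × m) ℂ}

/-- The state embedding intertwines all functions of the relative modular operators on the square
root of the state. -/
def Intertwines (Γ ρ : Matrix (a × m) (a × m) ℂ) : Prop :=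
  ∀ g : ℝ → ℝ, superCfc g (modular Γ ρ) (mpow ρ (1 / 2)) =
    stateEmbedding ρ (superCfc g (modular (trFst Γ) (trFst ρ)) (mpow (trFst ρ) (1 / 2)))

/-- Multiplying by `ρ^{1/2}` on the right turns `V z` into `(I ⊗ z ρ₂^{-1/2}) ρ`, whose partial
trace is `z ρ₂^{1/2}`. -/
theorem Intertwines.trFst_superCfc (h : Intertwines Γ ρ) (hΓ : Γ.PosSemidef) (hρ : ρ.PosSemidef)
    (g : ℝ → ℝ) :
    trFst (superCfc g (modular Γ ρ) ρ) =
      superCfc g (modular (trFst Γ) (trFst ρ)) (trFst ρ) := by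
  rw [superCfc_self hΓ.1 hρ, h g, superCfc_self (trFst_posSemidef hΓ).1 (trFst_posSemidef hρ),
    stateEmbedding_apply, Matrix.mul_assoc, mpow_half_mul_mpow_half hρ, trFst_one_kronecker_mul,
    Matrix.mul_assoc, mpow_neg_half_mul_self (trFst_posSemidef hρ)]

theorem quasiEntropy_eq_of_trace_eq (hΓ : Γ.PosSemidef) (hρ : ρ.PosSemidef) {f : ℝ → ℝ}
    (hf : IsRegular f) (hρ_tr : ρ.trace = 1)
    (hzero : Γ.PosDef ∨ Filter.Tendsto f (𝓝[>] 0) (𝓝 (f 0)))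
    (h : (superCfc f (modular Γ ρ) ρ).trace =
      (superCfc f (modular (trFst Γ) (trFst ρ)) (trFst ρ)).trace) (g : ℝ → ℝ) :
    (quasiEntropy Γ ρ g).re = (quasiEntropy (trFst Γ) (trFst ρ) g).re := by
  have : Nonempty a := by
    by_contra hne
    rw [not_nonempty_iff] at hne
    simp [Matrix.trace] at hρ_tr
  refine (isModularContraction_stateEmbedding hρ hΓ).quasiEntropy_eq_of_isRegular hΓ hρ
    (trFst_posSemidef hΓ) (trFst_posSemidef hρ) hf
    (hzero.imp_left fun hpd => ⟨hpd, trFst_posDef hpd⟩) ?_ g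
  rw [quasiEntropy_eq_trace hΓ.1 hρ, quasiEntropy_eq_trace (trFst_posSemidef hΓ).1
    (trFst_posSemidef hρ), h]

theorem intertwines_of_trace_eq (hΓ : Γ.PosSemidef) (hρ : ρ.PosSemidef) {f : ℝ → ℝ}
    (hf : IsRegular f) (hρ_tr : ρ.trace = 1)
    (hzero : Γ.PosDef ∨ Filter.Tendsto f (𝓝[>] 0) (𝓝 (f 0)))
    (h : (superCfc f (modular Γ ρ) ρ).trace =
      (superCfc f (modular (trFst Γ) (trFst ρ)) (trFst ρ)).trace) : Intertwines Γ ρ :=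
  (isModularContraction_stateEmbedding hρ hΓ).intertwine hΓ hρ (trFst_posSemidef hΓ)
    (trFst_posSemidef hρ)
    fun _ _ => (quasiEntropy_eq_of_trace_eq hΓ hρ hf hρ_tr hzero h _).le

theorem supp_eq_of_trace_eq (hΓ : Γ.PosDef) (hρ : ρ.PosSemidef) {f : ℝ → ℝ}
    (hf : IsRegular f) (hρ_tr : ρ.trace = 1)
    (h : (superCfc f (modular Γ ρ) ρ).trace =
      (superCfc f (modular (trFst Γ) (trFst ρ)) (trFst ρ)).trace) :
    (1 : Matrix a a ℂ) ⊗ₖ supp (trFst ρ) = supp ρ :=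
  supp_trFst_eq hρ hΓ
    fun _ _ => (quasiEntropy_eq_of_trace_eq hΓ.posSemidef hρ hf hρ_tr (Or.inl hΓ) h _).le

theorem mpow_mul_comm {n : Type*} [Fintype n] [DecidableEq n] (A : Matrix n n ℂ) (r s : ℝ) :
    mpow A r * mpow A s = mpow A s * mpow A r := by
  rw [mpow, mpow, cfc_mul_cfc, cfc_mul_cfc]
  simp only [mul_comm]

theorem stateEmbedding_superCfc_rpow (hΓ : Γ.PosSemidef) (hρ : ρ.PosSemidef) {β : ℝ}
    (hβ : β ≠ 0) :
    stateEmbedding ρ (superCfc (fun x => x ^ β) (modular (trFst Γ) (trFst ρ))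
      (mpow (trFst ρ) (1 / 2))) =
    ((1 : Matrix a a ℂ) ⊗ₖ (mpow (trFst Γ) β * mpow (trFst ρ) (-β))) * mpow ρ (1 / 2) := by
  have hρ' := trFst_posSemidef hρ
  rw [superCfc_rpow (trFst_posSemidef hΓ) hρ', stateEmbedding_apply, Matrix.mul_assoc,
    Matrix.mul_assoc, ← Matrix.mul_assoc (mpow (trFst ρ) (1 / 2)), mpow_mul_comm _ (1 / 2),
    Matrix.mul_assoc (mpow (trFst ρ) (-β)), mpow_mul_mpow_neg hρ' (by norm_num),
    mpow_mul_supp _ (neg_ne_zero.2 hβ)]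

theorem intertwines_of_mpow (hΓ : Γ.PosSemidef) (hρ : ρ.PosSemidef)
    (h : ∀ β ∈ Set.Ioo (0 : ℝ) 1,
      (1 : Matrix a a ℂ) ⊗ₖ (mpow (trFst Γ) β * mpow (trFst ρ) (-β)) =
        mpow Γ β * mpow ρ (-β)) : Intertwines Γ ρ := by
  have hρ' := trFst_posSemidef hρ
  have hΓ' := trFst_posSemidef hΓ
  intro g
  refine sub_eq_zero.1 (IsFinitelySupported.eq_zero_of_rpow
    ((superCfc_isFinitelySupported hΓ hρ (mpow ρ (1 / 2))).sub
      ((superCfc_isFinitelySupported hΓ' hρ' (mpow (trFst ρ) (1 / 2))).map (stateEmbedding ρ)))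
    ?_ (fun β hβ => ?_) g)
  · rw [superCfc_one hΓ.1 hρ.1, superCfc_one hΓ'.1 hρ'.1, stateEmbedding_sqrt hρ, sub_self]
  · rw [stateEmbedding_superCfc_rpow hΓ hρ hβ.1.ne', h β hβ, superCfc_rpow hΓ hρ,
      Matrix.mul_assoc, Matrix.mul_assoc, mpow_mul_comm, sub_self]

/-- Cancelling `ρ^{1/2}` on the right leaves `supp ρ`, which `ρ₂^{-β}` absorbs once it equals `I ⊗
supp ρ₂`. -/
theorem Intertwines.mpow_eq (h : Intertwines Γ ρ) (hΓ : Γ.PosSemidef) (hρ : ρ.PosSemidef)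
    (hsupp : (1 : Matrix a a ℂ) ⊗ₖ supp (trFst ρ) = supp ρ) {β : ℝ} (hβ : β ≠ 0) :
    (1 : Matrix a a ℂ) ⊗ₖ (mpow (trFst Γ) β * mpow (trFst ρ) (-β)) = mpow Γ β * mpow ρ (-β) := by
  have h1 := h fun x => x ^ β
  rw [stateEmbedding_superCfc_rpow hΓ hρ hβ, superCfc_rpow hΓ hρ, Matrix.mul_assoc,
    mpow_mul_comm, ← Matrix.mul_assoc] at h1
  have h2 := congrArg (· * mpow ρ (-(1 / 2))) h1
  simp only [Matrix.mul_assoc] at h2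
  rwa [mpow_mul_mpow_neg hρ (by norm_num), mpow_mul_supp _ (neg_ne_zero.2 hβ), ← hsupp,
    ← one_kronecker_mul, Matrix.mul_assoc, mpow_mul_supp _ (neg_ne_zero.2 hβ), eq_comm] at h2

theorem supp_trFst_of_posDef [Nonempty a] (hρ : ρ.PosDef) :
    (1 : Matrix a a ℂ) ⊗ₖ supp (trFst ρ) = supp ρ := by
  rw [supp_eq_one hρ, supp_eq_one (trFst_posDef hρ), one_kronecker_one]

/-- The power identity at `β = 1/2` solves for `Γ^{1/2}`; then `Γ = (Γ^{1/2})* Γ^{1/2}`. -/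
theorem Intertwines.petz_eq [Nonempty a] (h : Intertwines Γ ρ) (hΓ : Γ.PosSemidef)
    (hρ : ρ.PosDef) : petz ρ (trFst Γ) = Γ := by
  have h1 := h.mpow_eq hΓ hρ.posSemidef (supp_trFst_of_posDef hρ) (β := 1 / 2) (by norm_num)
  have h2 := congrArg (· * mpow ρ (1 / 2)) h1
  simp only [Matrix.mul_assoc] at h2
  rw [mpow_neg_mul_mpow hρ.posSemidef (by norm_num), supp_eq_one hρ, Matrix.mul_one] at h2
  have h3 : (mpow Γ (1 / 2))ᴴ * mpow Γ (1 / 2) = Γ := by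
    rw [conjTranspose_mpow, mpow_half_mul_mpow_half hΓ]
  rw [← h2, conjTranspose_mul, conjTranspose_one_kronecker, conjTranspose_mul, conjTranspose_mpow,
    conjTranspose_mpow, conjTranspose_mpow, Matrix.mul_assoc, ← Matrix.mul_assoc (_ ⊗ₖ _),
    ← one_kronecker_mul] at h3
  rw [petz, Matrix.mul_assoc]
  convert h3 using 4
  conv_lhs => rw [← mpow_half_mul_mpow_half (trFst_posSemidef hΓ)]
  simp only [Matrix.mul_assoc]

/-- Monotonicity along the reverse contraction supplies the opposite inequality between resolvent
quasi-entropies, which is the equality case for `V`. -/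
theorem intertwines_of_petz [Nonempty a] (hΓ : Γ.PosSemidef) (hρ : ρ.PosDef)
    (h : petz ρ (trFst Γ) = Γ) : Intertwines Γ ρ :=
  (isModularContraction_stateEmbedding hρ.posSemidef hΓ).intertwine hΓ hρ.posSemidef
    (trFst_posSemidef hΓ) (trFst_posSemidef hρ.posSemidef)
    fun _ ht => (isModularContraction_petzEmbedding hρ hΓ h).quasiEntropy_resolvent_le
      (trFst_posSemidef hΓ) (trFst_posSemidef hρ.posSemidef) hΓ hρ.posSemidef ht

end Equivalences

/-! ### Compatibility of powers and partial traces with tensoring by the identity -/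

section TensorOne

variable {a b c : Type*} [Fintype a] [DecidableEq a] [Fintype b] [DecidableEq b]
  [Fintype c] [DecidableEq c]

theorem mpow_kronecker_one {n : Type*} [Fintype n] [DecidableEq n] {A : Matrix n n ℂ}
    (hA : A.IsHermitian) (r : ℝ) :
    mpow (A ⊗ₖ (1 : Matrix c c ℂ)) r = mpow A r ⊗ₖ (1 : Matrix c c ℂ) := by
  obtain ⟨P, hP, hAP⟩ := exists_isResolution hA
  have h1 : IsResolution fun _ : Unit => (1 : Matrix c c ℂ) :=
    ⟨fun _ => conjTranspose_one, fun _ _ => by simp, by simp⟩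
  have h2 : ∀ d : n → ℝ, (∑ i, (d i : ℂ) • P i) ⊗ₖ (1 : Matrix c c ℂ) =
      ∑ k : n × Unit, (d k.1 : ℂ) • (P k.1 ⊗ₖ (1 : Matrix c c ℂ)) := by
    intro d
    rw [Fintype.sum_prod_type]
    ext i j
    simp [Matrix.sum_apply, kroneckerMap_apply, Finset.sum_mul, mul_assoc]
  conv_lhs => rw [hAP, h2]
  conv_rhs => rw [hAP, hP.mpow_sum, h2]
  exact (hP.kronecker h1).mpow_sum _ r

theorem mpow_reindex {n k : Type*} [Fintype n] [DecidableEq n] [Fintype k] [DecidableEq k]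
    {A : Matrix n n ℂ} (hA : A.IsHermitian) (e : n ≃ k) (r : ℝ) :
    mpow (Matrix.reindex e e A) r = Matrix.reindex e e (mpow A r) := by
  obtain ⟨P, hP, hAP⟩ := exists_isResolution hA
  have h1 : IsResolution fun i => Matrix.reindex e e (P i) :=
    { herm := fun i => by rw [conjTranspose_reindex, hP.herm]
      mul := fun i j => by
        rw [reindex_apply, reindex_apply, submatrix_mul_equiv, hP.mul]
        split_ifs <;> simp
      sum := by
        ext i j
        have := congrFun (congrFun hP.sum (e.symm i)) (e.symm j)
        simpa [Matrix.sum_apply, Matrix.one_apply] using this }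
  have h2 : ∀ d : n → ℝ, Matrix.reindex e e (∑ i, (d i : ℂ) • P i) =
      ∑ i, (d i : ℂ) • Matrix.reindex e e (P i) := by
    intro d
    ext i j
    simp [Matrix.sum_apply]
  conv_lhs => rw [hAP, h2]
  conv_rhs => rw [hAP, hP.mpow_sum, h2]
  exact h1.mpow_sum _ r

theorem tensorOne_posSemidef {σ : Matrix (a × b) (a × b) ℂ} (hσ : σ.PosSemidef) :
    (tensorOne (c := c) σ).PosSemidef :=
  (hσ.kronecker PosSemidef.one).submatrix _

theorem tensorOne_posDef {σ : Matrix (a × b) (a × b) ℂ} (hσ : σ.PosDef) :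
    (tensorOne (c := c) σ).PosDef :=
  (hσ.kronecker PosDef.one).submatrix (Equiv.injective _)

theorem trFst_tensorOne (σ : Matrix (a × b) (a × b) ℂ) :
    trFst (tensorOne (c := c) σ) = trFst σ ⊗ₖ (1 : Matrix c c ℂ) := by
  ext ⟨i, k⟩ ⟨j, l⟩
  simp [trFst, tensorOne, kroneckerMap_apply, Finset.sum_mul]

theorem mpow_tensorOne {σ : Matrix (a × b) (a × b) ℂ} (hσ : σ.PosSemidef) (r : ℝ) :
    mpow (tensorOne (c := c) σ) r = tensorOne (mpow σ r) := by
  rw [tensorOne, mpow_reindex (hσ.kronecker PosSemidef.one).1, mpow_kronecker_one hσ.1, tensorOne]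

end TensorOne

end RuskaiEquality

end

end QuasiEntropy

open QuasiEntropy

theorem proposition6p6 {a b c : Type*} [Fintype a] [DecidableEq a] [Fintype b] [DecidableEq b]
    [Fintype c] [DecidableEq c] (f : ℝ → ℝ) (hf : QuasiEntropy.IsRegular f)
    (ρ : Matrix (a × b × c) (a × b × c) ℂ) (hρ : ρ.PosSemidef) (hρ_tr : ρ.trace = 1)
    (σ : Matrix (a × b) (a × b) ℂ) (hσ : σ.PosSemidef)
    (hσf : σ.PosDef ∨ Filter.Tendsto f (𝓝[>] 0) (𝓝 (f 0)))
    (hρσ : ρ.PosDef ∨ σ.PosDef) :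
    (QuasiEntropy.RuskaiEquality f ρ σ ↔
      ∀ β ∈ Set.Ioo (0 : ℝ) 1,
        (1 : Matrix a a ℂ) ⊗ₖ ((QuasiEntropy.mpow (QuasiEntropy.trFst σ) β ⊗ₖ (1 : Matrix c c ℂ)) *
            QuasiEntropy.mpow (QuasiEntropy.trFst ρ) (-β)) =
          QuasiEntropy.tensorOne (QuasiEntropy.mpow σ β) * QuasiEntropy.mpow ρ (-β)) ∧
    (ρ.PosDef →
      (QuasiEntropy.RuskaiEquality f ρ σ ↔
        QuasiEntropy.petz ρ (QuasiEntropy.trFst σ ⊗ₖ (1 : Matrix c c ℂ)) =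
          QuasiEntropy.tensorOne σ)) := by
  have hne : Nonempty a := by
    by_contra hne
    rw [not_nonempty_iff] at hne
    simp [Matrix.trace] at hρ_tr
  have hΓ : (tensorOne (c := c) σ).PosSemidef := tensorOne_posSemidef hσ
  have htr : RuskaiEquality f ρ σ →
      (superCfc f (modular (tensorOne σ) ρ) ρ).trace =
        (superCfc f (modular (trFst (tensorOne σ)) (trFst ρ)) (trFst ρ)).trace := by
    intro h
    have := congrArg Matrix.trace h
    rwa [trace_trFst, trace_trFst, trace_trFst, ← trFst_tensorOne] at this
  -- Only the trace over C of the operator equality is used forwards; backwards, the identity holds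
  -- already before tracing out B.
  have hInt : RuskaiEquality f ρ σ ↔ Intertwines (tensorOne σ) ρ := by
    refine ⟨fun h => intertwines_of_trace_eq hΓ hρ hf hρ_tr (hσf.imp_left tensorOne_posDef) (htr h),
      fun h => ?_⟩
    rw [RuskaiEquality, h.trFst_superCfc hΓ hρ, trFst_tensorOne]
  have hsupp : RuskaiEquality f ρ σ → (1 : Matrix a a ℂ) ⊗ₖ supp (trFst ρ) = supp ρ := by
    intro h
    rcases hρσ with h1 | h1
    · exact supp_trFst_of_posDef h1
    · exact supp_eq_of_trace_eq (tensorOne_posDef h1) hρ hf hρ_tr (htr h)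
  have hpow : ∀ β, mpow (trFst σ) β ⊗ₖ (1 : Matrix c c ℂ) = mpow (trFst (tensorOne σ)) β :=
    fun β => by rw [trFst_tensorOne, mpow_kronecker_one (trFst_posSemidef hσ).1]
  refine ⟨⟨fun h β hβ => ?_, fun h => hInt.2 (intertwines_of_mpow hΓ hρ fun β hβ => ?_)⟩,
    fun hpd => ⟨fun h => ?_, fun h => hInt.2 (intertwines_of_petz hΓ hpd ?_)⟩⟩
  · rw [hpow, ← mpow_tensorOne hσ]
    exact (hInt.1 h).mpow_eq hΓ hρ (hsupp h) hβ.1.ne'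
  · rw [mpow_tensorOne hσ, ← hpow]
    exact h β hβ
  · rw [← trFst_tensorOne]
    exact (hInt.1 h).petz_eq hΓ hpd
  · rw [trFst_tensorOne]
    exact h
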